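/- **Zalgaller's theorem.** Let $P$ be a $2$-dimensional polyhedral space. Then there is a piecewise distance preserving map $f\colon P\to\mathbb{R}^2$. Here an *$n$-dimensional polyhedral space* is a metric space $P$ that admits a finite simplicial triangulation in which every simplex is identified with a nondegenerate Euclidean simplex of dimension at most $n$, at least one of them of dimension $n$, such that the identifications of a simplex and of each of its faces agree up to isometry, and such that the metric of $P$ is the length metric of the space so glued: the distance between two points is finite and equals the infimum of the lengths of the broken lines between them, where a broken line is a finite concatenation of straight segments, each lying in one simplex and measured in that Euclidean simplex. By a *triangulation* of $P$ we always mean a triangulation with these properties (by finitely many Euclidean simplices, with the metric of $P$ as the associated length metric). A map $f\colon P\to\mathbb{R}^m$ is *piecewise distance preserving* if there is a triangulation of $P$ such that $|f(x)-f(y)|=|x-y|_P$ whenever $x$ and $y$ lie in a common simplex of it. The plane $\mathbb{R}^2$ and the spaces $\mathbb{R}^m$ carry the Euclidean metric. -/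

import Mathlib

/-- A finite triangulation of a set `P` by Euclidean simplices of dimension at most `n`.

The vertices are points of `P`; a simplex is given by its finite set of vertices `s ∈ faces`, it
occupies the subset `carrier s` of `P`, and `chart s` identifies `carrier s` with a nondegenerate
simplex of `ℝⁿ`, so that each face of the simplex is identified with the face of the Euclidean
simplex on the corresponding vertices. The charts of a simplex and of its faces agree up to
isometry, any two simplices meet in the empty set or in a common face, and the simplices cover `P`.
The values of `carrier` and `chart` off `faces`, and of `chart s` off `carrier s`, are irrelevant. -/
structure EuclideanTriangulation (n : ℕ) (P : Type*) where
  /-- The vertex sets of the simplices. -/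
  faces : Set (Finset P)
  /-- The closed simplex with a given set of vertices. -/
  carrier : Finset P → Set P
  /-- The identification of a simplex with a simplex in Euclidean space. -/
  chart : Finset P → P → EuclideanSpace ℝ (Fin n)
  finite_faces : faces.Finite
  nonempty_of_mem : ∀ s ∈ faces, s.Nonempty
  down_closed : ∀ s ∈ faces, ∀ t : Finset P, t ⊆ s → t.Nonempty → t ∈ faces
  vertices_subset : ∀ s ∈ faces, (s : Set P) ⊆ carrier s
  chart_injOn : ∀ s ∈ faces, Set.InjOn (chart s) (carrier s)
  affineIndependent : ∀ s ∈ faces, AffineIndependent ℝ (fun v : s => chart s v)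
  carrier_mono : ∀ s ∈ faces, ∀ t ∈ faces, t ⊆ s → carrier t ⊆ carrier s
  /-- For `t = s` this says that the image of the whole simplex is a Euclidean simplex. -/
  chart_image : ∀ s ∈ faces, ∀ t ∈ faces, t ⊆ s →
    chart s '' carrier t = convexHull ℝ (chart s '' (t : Set P))
  dist_chart : ∀ s ∈ faces, ∀ t ∈ faces, t ⊆ s → ∀ x ∈ carrier t, ∀ y ∈ carrier t,
    dist (chart t x) (chart t y) = dist (chart s x) (chart s y)
  inter : ∀ s ∈ faces, ∀ t ∈ faces, ∀ x ∈ carrier s ∩ carrier t,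
    ∃ u ∈ faces, u ⊆ s ∧ u ⊆ t ∧ x ∈ carrier u
  cover : ∀ x : P, ∃ s ∈ faces, x ∈ carrier s

namespace EuclideanTriangulation

variable {n : ℕ} {P : Type*}

/-- `T.BrokenLine x y L`: there is a broken line of length `L` from `x` to `y`, that is, a finite
concatenation of straight segments each of which lies in a simplex of `T`. -/
inductive BrokenLine (T : EuclideanTriangulation n P) : P → P → ℝ → Prop
  | refl (x : P) : BrokenLine T x x 0
  | step {x y z : P} {L : ℝ} {s : Finset P} : BrokenLine T x y L → s ∈ T.faces →
      y ∈ T.carrier s → z ∈ T.carrier s →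
      BrokenLine T x z (L + dist (T.chart s y) (T.chart s z))

/-- The metric of `P` is the length metric of the space glued from the Euclidean simplices of `T`:
the distance between two points is the infimum of the lengths of the broken lines between them.
In particular (since `ℝ` has no greatest element) any two points are joined by a broken line. -/
def InducesMetric [MetricSpace P] (T : EuclideanTriangulation n P) : Prop :=
  ∀ x y : P, IsGLB {L : ℝ | T.BrokenLine x y L} (dist x y)

end EuclideanTriangulation

/-- An `n`-dimensional polyhedral space: a metric space glued from finitely many Euclidean simplices
of dimension at most `n`, at least one of them of dimension `n`, with its length metric. -/
def IsPolyhedralSpace (n : ℕ) (P : Type*) [MetricSpace P] : Prop :=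
  ∃ T : EuclideanTriangulation n P, T.InducesMetric ∧ ∃ s ∈ T.faces, s.card = n + 1

/-- A map to `ℝᵐ` is piecewise distance preserving if, for some triangulation of the polyhedral
space `P`, its restriction to every simplex preserves the distances of `P`. -/
def IsPiecewiseDistancePreserving {P : Type*} [MetricSpace P] {m : ℕ}
    (f : P → EuclideanSpace ℝ (Fin m)) : Prop :=
  ∃ (n : ℕ) (T : EuclideanTriangulation n P), T.InducesMetric ∧
    ∀ s ∈ T.faces, ∀ x ∈ T.carrier s, ∀ y ∈ T.carrier s, dist (f x) (f y) = dist x y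

/-!
Let `T` be a triangulation of `P`. Place a finite set of *sites* on the edges of `T`, and consider in
each triangle the Voronoi diagram of the sites on it. The map to be constructed sends a point at
distance `r` from its nearest sites to a point at distance `r` from the origin; in particular all
sites go to the origin.

If the sites on each edge are equally spaced, with spacings that are almost the same for all edges,
then among the sites of a triangle those nearest to a point of a side lie on that side
(`EuclideanTriangulation.exists_isSites`, which rests on the inequality `exists_closer`). Hence the
Voronoi diagrams agree along the edges of `T`, and the sites nearest to a point of `P` are
well-defined. The points with several nearest sites form a graph, the cut locus. Its nodes are the
vertices of the Voronoi diagrams of the triangles together with the midpoints between neighbouring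
sites of an edge of `T`; its edges are the Voronoi edges in the triangles. Each Voronoi cell is the
cone over a part of the cut locus with apex at the site (`IsSites.exists_ray`,
`IsComb.ray_unique`), so the cones over the edges of the cut locus triangulate `P`.

The cones over an edge from the two sites next to it are congruent. Therefore the bisectors of their
angles at the apices meet the edge in the same point, `IsBisector`. Dividing each edge of the cut
locus there yields a triangulation of `P` in which every triangle has for its vertices a site, a
node and a bisecting point. Now fold each cone along its bisector: sites go to the origin, nodes to
the positive first axis, and bisecting points to the position above the axis which is forced by
the distances from the site and a node; by the choice of the point it does not matter which
site and which node (`IsBisector.abscissa_eq`, `IsSites.dist_foldVertex_half`). This preserves the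
distances of the vertices of each simplex, so the affine extension `f` is an isometry on each of them.

That the extension is piecewise distance preserving is a general fact about subdivisions
(`IsSubdivision.isPiecewiseDistancePreserving`). The map `f` itself serves as the chart of each
simplex of the subdivision, broken lines of the subdivision and of `T` have the same lengths, and `f`
does not increase the length of broken lines. For points `x`, `y` of one simplex this gives
`dist (f x) (f y) ≤ dist x y`, while the straight segment between them has length
`dist (f x) (f y)`, which gives the other inequality.
-/

/-! ### Convex combinations -/

/-- A convex combination of the points `c v`, `v ∈ u`, with weights indexed by `v` (the map `c` need
not be injective on `u`). -/
theorem mem_convexHull_image_finset {ι V : Type*} [AddCommGroup V] [Module ℝ V] {u : Finset ι}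
    {c : ι → V} {p : V} :
    p ∈ convexHull ℝ (c '' (u : Set ι)) ↔
      ∃ l : ι → ℝ, (∀ v ∈ u, 0 ≤ l v) ∧ ∑ v ∈ u, l v = 1 ∧ ∑ v ∈ u, l v • c v = p := by
  classical
  constructor
  · intro hp
    have hconv : Convex ℝ {p : V | ∃ l : ι → ℝ, (∀ v ∈ u, 0 ≤ l v) ∧ ∑ v ∈ u, l v = 1 ∧
        ∑ v ∈ u, l v • c v = p} := by
      rintro _ ⟨l, hl, hl1, rfl⟩ _ ⟨k, hk, hk1, rfl⟩ a b ha hb hab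
      refine ⟨fun v => a * l v + b * k v, fun v hv => ?_, ?_, ?_⟩
      · have := hl v hv
        have := hk v hv
        positivity
      · rw [Finset.sum_add_distrib, ← Finset.mul_sum, ← Finset.mul_sum, hl1, hk1]
        linarith
      · simp only [add_smul, mul_smul, Finset.sum_add_distrib, Finset.smul_sum]
    refine convexHull_min ?_ hconv hp
    rintro _ ⟨v, hv, rfl⟩
    refine ⟨fun i => if i = v then 1 else 0, fun i _ => by dsimp only; split_ifs <;> norm_num, ?_, ?_⟩
    · simpa using hv
    · simp only [ite_smul, one_smul, zero_smul]
      rw [Finset.sum_ite_eq' u v]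
      simp [Finset.mem_coe.1 hv]
  · rintro ⟨l, hl, hl1, rfl⟩
    exact (convex_convexHull ℝ _).sum_mem hl hl1 fun v hv =>
      subset_convexHull ℝ _ ⟨v, hv, rfl⟩

/-- Linear relations with total weight zero only depend on the mutual distances of the points. -/
theorem norm_sum_smul_eq_of_dist_eq {ι V W : Type*} [NormedAddCommGroup V]
    [InnerProductSpace ℝ V] [NormedAddCommGroup W] [InnerProductSpace ℝ W] {u : Finset ι}
    {p : ι → V} {q : ι → W} (h : ∀ i ∈ u, ∀ j ∈ u, dist (p i) (p j) = dist (q i) (q j))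
    {l : ι → ℝ} (hl : ∑ i ∈ u, l i = 0) :
    ‖∑ i ∈ u, l i • p i‖ = ‖∑ i ∈ u, l i • q i‖ := by
  have key : ‖∑ i ∈ u, l i • p i‖ ^ 2 = ‖∑ i ∈ u, l i • q i‖ ^ 2 := by
    rw [← real_inner_self_eq_norm_sq, ← real_inner_self_eq_norm_sq,
      inner_sum_smul_sum_smul_of_sum_eq_zero _ hl _ hl,
      inner_sum_smul_sum_smul_of_sum_eq_zero _ hl _ hl]
    congr 2
    refine Finset.sum_congr rfl fun i hi => Finset.sum_congr rfl fun j hj => ?_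
    rw [← dist_eq_norm, ← dist_eq_norm, h i hi j hj]
  exact (pow_left_inj₀ (norm_nonneg _) (norm_nonneg _) two_ne_zero).1 key

/-- A convex combination is transported by a map which preserves the mutual distances of the points
involved. -/
theorem sum_smul_eq_of_dist_eq {ι V W : Type*} [NormedAddCommGroup V]
    [InnerProductSpace ℝ V] [NormedAddCommGroup W] [InnerProductSpace ℝ W] {u : Finset ι} {x : ι}
    {p : ι → V} {q : ι → W}
    (h : ∀ i ∈ insert x (u : Set ι), ∀ j ∈ insert x (u : Set ι), dist (p i) (p j) = dist (q i) (q j))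
    {l : ι → ℝ} (hl : ∑ i ∈ u, l i = 1) (hx : ∑ i ∈ u, l i • p i = p x) :
    ∑ i ∈ u, l i • q i = q x := by
  classical
  have h' : ∀ i ∈ Finset.insertNone u, ∀ j ∈ Finset.insertNone u,
      dist (i.elim (p x) p) (j.elim (p x) p) = dist (i.elim (q x) q) (j.elim (q x) q) := by
    rintro (_ | i) hi (_ | j) hj <;> simp at hi hj <;> simp [h, hi, hj]
  have := norm_sum_smul_eq_of_dist_eq h' (l := fun i => i.elim (-1) l)
    (by rw [Finset.sum_insertNone]; simp [hl])
  rw [Finset.sum_insertNone, Finset.sum_insertNone] at this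
  simp only [Option.elim] at this
  rw [hx] at this
  have h0 : ‖(-1 : ℝ) • q x + ∑ i ∈ u, l i • q i‖ = 0 := by rw [← this]; simp
  rw [norm_eq_zero, neg_one_smul, neg_add_eq_zero] at h0
  exact h0.symm

namespace EuclideanTriangulation

/-! ### Minimal faces and barycentric coordinates -/

variable {n : ℕ} {P : Type*} (T : EuclideanTriangulation n P)

open Classical in
theorem mem_inter {s t : Finset P} (hs : s ∈ T.faces) (ht : t ∈ T.faces) {x : P}
    (hxs : x ∈ T.carrier s) (hxt : x ∈ T.carrier t) :
    s ∩ t ∈ T.faces ∧ x ∈ T.carrier (s ∩ t) := by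
  obtain ⟨u, hu, hus, hut, hxu⟩ := T.inter s hs t ht x ⟨hxs, hxt⟩
  have hsub : u ⊆ s ∩ t := Finset.subset_inter hus hut
  have hst : s ∩ t ∈ T.faces := T.down_closed s hs _ Finset.inter_subset_left
    ((T.nonempty_of_mem u hu).mono hsub)
  exact ⟨hst, T.carrier_mono _ hst _ hu hsub hxu⟩

/-- The Euclidean distance of two points of a common simplex does not depend on the simplex. -/
theorem dist_chart_eq {s t : Finset P} (hs : s ∈ T.faces) (ht : t ∈ T.faces) {x y : P}
    (hxs : x ∈ T.carrier s) (hys : y ∈ T.carrier s) (hxt : x ∈ T.carrier t)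
    (hyt : y ∈ T.carrier t) :
    dist (T.chart s x) (T.chart s y) = dist (T.chart t x) (T.chart t y) := by
  classical
  obtain ⟨h, hx⟩ := T.mem_inter hs ht hxs hxt
  obtain ⟨-, hy⟩ := T.mem_inter hs ht hys hyt
  rw [← T.dist_chart s hs _ h Finset.inter_subset_left x hx y hy,
    ← T.dist_chart t ht _ h Finset.inter_subset_right x hx y hy]

theorem image_carrier {s : Finset P} (hs : s ∈ T.faces) :
    T.chart s '' T.carrier s = convexHull ℝ (T.chart s '' (s : Set P)) :=
  T.chart_image s hs s hs subset_rfl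

theorem convex_image_carrier {s t : Finset P} (hs : s ∈ T.faces) (ht : t ∈ T.faces)
    (hts : t ⊆ s) : Convex ℝ (T.chart s '' T.carrier t) := by
  rw [T.chart_image s hs t ht hts]
  exact convex_convexHull ℝ _

theorem exists_minimal_face (x : P) :
    ∃ s ∈ T.faces, x ∈ T.carrier s ∧ ∀ t ∈ T.faces, x ∈ T.carrier t → s ⊆ t := by
  classical
  obtain ⟨s0, hs0, hx0⟩ := T.cover x
  have hne : {s | s ∈ T.faces ∧ x ∈ T.carrier s}.Nonempty := ⟨s0, hs0, hx0⟩
  obtain ⟨s, ⟨hs, hx⟩, hmin⟩ := exists_minimalFor_of_wellFoundedLT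
    (fun s => s ∈ T.faces ∧ x ∈ T.carrier s) Finset.card hne
  refine ⟨s, hs, hx, fun t ht hxt => ?_⟩
  have := T.mem_inter hs ht hx hxt
  have hc := hmin this (Finset.card_le_card Finset.inter_subset_left)
  exact Finset.inter_eq_left.1 (Finset.eq_of_subset_of_card_le Finset.inter_subset_left hc)

/-- The smallest simplex containing a point. -/
noncomputable def supp (x : P) : Finset P := (T.exists_minimal_face x).choose

theorem supp_mem (x : P) : T.supp x ∈ T.faces := (T.exists_minimal_face x).choose_spec.1

theorem mem_carrier_supp (x : P) : x ∈ T.carrier (T.supp x) :=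
  (T.exists_minimal_face x).choose_spec.2.1

theorem supp_subset {x : P} {t : Finset P} (ht : t ∈ T.faces) (hx : x ∈ T.carrier t) :
    T.supp x ⊆ t :=
  (T.exists_minimal_face x).choose_spec.2.2 t ht hx

theorem exists_weights {s : Finset P} (hs : s ∈ T.faces) {x : P} (hx : x ∈ T.carrier s) :
    ∃ l : P → ℝ, (∀ v ∈ s, 0 ≤ l v) ∧ ∑ v ∈ s, l v = 1 ∧
      ∑ v ∈ s, l v • T.chart s v = T.chart s x := by
  rw [← mem_convexHull_image_finset, ← T.image_carrier hs]
  exact ⟨x, hx, rfl⟩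

theorem weights_eq {s : Finset P} (hs : s ∈ T.faces) {l k : P → ℝ}
    (h1 : ∑ v ∈ s, l v = ∑ v ∈ s, k v)
    (h : ∑ v ∈ s, l v • T.chart s v = ∑ v ∈ s, k v • T.chart s v) :
    ∀ v ∈ s, l v = k v := by
  have hi := (affineIndependent_iff (k := ℝ)).1 (T.affineIndependent s hs) Finset.univ
    (fun v => l v - k v) (by
      rw [Finset.sum_coe_sort s (fun v => l v - k v), Finset.sum_sub_distrib, h1, sub_self]) (by
      rw [Finset.sum_coe_sort s (fun v => (l v - k v) • T.chart s v)]
      simp only [sub_smul, Finset.sum_sub_distrib, h, sub_self])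
  intro v hv
  have := hi ⟨v, hv⟩ (Finset.mem_univ _)
  simp only at this
  linarith

/-- A point all of whose barycentric coordinates off a face vanish lies on that face. -/
theorem mem_carrier_of_weights {s t : Finset P} (hs : s ∈ T.faces) (ht : t ∈ T.faces)
    (hts : t ⊆ s) {x : P} (hx : x ∈ T.carrier s) {l : P → ℝ} (hl : ∀ v ∈ s, 0 ≤ l v)
    (hl1 : ∑ v ∈ s, l v = 1) (hlx : ∑ v ∈ s, l v • T.chart s v = T.chart s x)
    (h0 : ∀ v ∈ s, v ∉ t → l v = 0) : x ∈ T.carrier t := by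
  have : T.chart s x ∈ T.chart s '' T.carrier t := by
    rw [T.chart_image s hs t ht hts, mem_convexHull_image_finset]
    refine ⟨l, fun v hv => hl v (hts hv), ?_, ?_⟩
    · rw [← hl1]
      exact Finset.sum_subset hts h0
    · rw [← hlx]
      exact Finset.sum_subset hts fun v hv hvt => by rw [h0 v hv hvt, zero_smul]
  obtain ⟨y, hy, hxy⟩ := this
  rwa [← T.chart_injOn s hs (T.carrier_mono s hs t ht hts hy) hx hxy]

theorem weights_eq_zero {s t : Finset P} (hs : s ∈ T.faces) (ht : t ∈ T.faces)
    (hts : t ⊆ s) {x : P} (hx : x ∈ T.carrier t) {l : P → ℝ}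
    (hl1 : ∑ v ∈ s, l v = 1) (hlx : ∑ v ∈ s, l v • T.chart s v = T.chart s x) :
    ∀ v ∈ s, v ∉ t → l v = 0 := by
  classical
  have : T.chart s x ∈ convexHull ℝ (T.chart s '' (t : Set P)) := by
    rw [← T.chart_image s hs t ht hts]
    exact ⟨x, hx, rfl⟩
  obtain ⟨k, -, hk1, hkx⟩ := mem_convexHull_image_finset.1 this
  intro v hv hvt
  have := T.weights_eq hs (l := l) (k := fun v => if v ∈ t then k v else 0) ?_ ?_ v hv
  · simpa [hvt] using this
  · rw [hl1, ← hk1, ← Finset.sum_filter, Finset.filter_mem_eq_inter, Finset.inter_eq_right.2 hts]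
  · simp only [ite_smul, zero_smul]
    rw [hlx, ← hkx, ← Finset.sum_filter, Finset.filter_mem_eq_inter, Finset.inter_eq_right.2 hts]

theorem weights_supp_pos {x : P} {l : P → ℝ} (hl : ∀ v ∈ T.supp x, 0 ≤ l v)
    (hl1 : ∑ v ∈ T.supp x, l v = 1)
    (hlx : ∑ v ∈ T.supp x, l v • T.chart (T.supp x) v = T.chart (T.supp x) x) :
    ∀ v ∈ T.supp x, 0 < l v := by
  classical
  intro v hv
  refine (hl v hv).lt_of_ne fun h0 => ?_
  have hne : ((T.supp x).erase v).Nonempty := by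
    by_contra hne
    rw [Finset.not_nonempty_iff_eq_empty] at hne
    rw [← Finset.add_sum_erase _ _ hv, hne, ← h0] at hl1
    simp at hl1
  have hf := T.down_closed _ (T.supp_mem x) _ (Finset.erase_subset v _) hne
  have hx := T.mem_carrier_of_weights (T.supp_mem x) hf (Finset.erase_subset v _)
    (T.mem_carrier_supp x) hl hl1 hlx (fun w hw hwv => by
      have : w = v := by
        by_contra hne
        exact hwv (Finset.mem_erase.2 ⟨hne, hw⟩)
      rw [this, ← h0])
  exact Finset.notMem_erase v _ (T.supp_subset hf hx hv)

theorem exists_weights_face {s t : Finset P} (hs : s ∈ T.faces) (ht : t ∈ T.faces) (hts : t ⊆ s)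
    {x : P} (hx : x ∈ T.carrier t) :
    ∃ l : P → ℝ, (∀ v ∈ t, 0 ≤ l v) ∧ ∑ v ∈ t, l v = 1 ∧
      ∑ v ∈ t, l v • T.chart s v = T.chart s x := by
  rw [← mem_convexHull_image_finset, ← T.chart_image s hs t ht hts]
  exact ⟨x, hx, rfl⟩

/-- An open simplex is relatively open: a point may be moved a little in every direction tangent to
its minimal simplex. -/
theorem eventually_mem_convexHull {s : Finset P} (hs : s ∈ T.faces) {x : P} (hx : x ∈ T.carrier s)
    {c : P → ℝ} (hc0 : ∑ p ∈ T.supp x, c p = 0) :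
    ∀ᶠ δ : ℝ in nhdsWithin 0 (Set.Ioi 0),
      T.chart s x + δ • ∑ p ∈ T.supp x, c p • T.chart s p ∈
        convexHull ℝ (T.chart s '' (s : Set P)) := by
  have hsub := T.supp_subset hs hx
  obtain ⟨l, hl, hl1, hlx⟩ := T.exists_weights_face hs (T.supp_mem x) hsub (T.mem_carrier_supp x)
  have hpos : ∀ v ∈ T.supp x, 0 < l v := by
    refine T.weights_supp_pos hl hl1 (sum_smul_eq_of_dist_eq (p := T.chart s) ?_ hl1 hlx)
    have h1 : insert x (T.supp x : Set P) ⊆ T.carrier (T.supp x) :=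
      Set.insert_subset (T.mem_carrier_supp x) (T.vertices_subset _ (T.supp_mem x))
    exact fun i hi j hj =>
      (T.dist_chart s hs _ (T.supp_mem x) hsub i (h1 hi) j (h1 hj)).symm
  have : ∀ᶠ δ : ℝ in nhds 0, ∀ p ∈ T.supp x, 0 < l p + δ * c p := by
    rw [Filter.eventually_all_finset]
    intro p hp
    have hcont : Continuous fun δ : ℝ => l p + δ * c p := by fun_prop
    exact hcont.continuousAt.eventually (lt_mem_nhds (by simpa using hpos p hp))
  filter_upwards [this.filter_mono nhdsWithin_le_nhds] with δ hδ
  refine convexHull_mono (Set.image_mono (Finset.coe_subset.2 hsub)) ?_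
  rw [mem_convexHull_image_finset]
  refine ⟨fun p => l p + δ * c p, fun p hp => (hδ p hp).le, ?_, ?_⟩
  · rw [Finset.sum_add_distrib, ← Finset.mul_sum, hl1, hc0, mul_zero, add_zero]
  · simp only [add_smul, mul_smul, Finset.sum_add_distrib, Finset.smul_sum, hlx]

theorem card_le {s : Finset P} (hs : s ∈ T.faces) : s.card ≤ n + 1 := by
  have := (T.affineIndependent s hs).card_le_finrank_succ
  rw [Fintype.card_coe] at this
  refine this.trans (Nat.succ_le_succ ?_)
  simpa using Submodule.finrank_le (vectorSpan ℝ (Set.range fun v : s => T.chart s v))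

/-- Every direction is tangent to a simplex of top dimension. -/
theorem exists_tangent_weights {s : Finset P} (hs : s ∈ T.faces) (hcard : s.card = n + 1)
    (v : EuclideanSpace ℝ (Fin n)) :
    ∃ c : P → ℝ, ∑ p ∈ s, c p = 0 ∧ ∑ p ∈ s, c p • T.chart s p = v := by
  classical
  have htop : affineSpan ℝ (Set.range fun p : s => T.chart s p) = ⊤ :=
    (T.affineIndependent s hs).affineSpan_eq_top_iff_card_eq_finrank_add_one.2 (by simpa using hcard)
  obtain ⟨x, hx⟩ := T.nonempty_of_mem s hs
  obtain ⟨l, hl1, hl⟩ := eq_affineCombination_of_mem_affineSpan_of_fintype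
    (show T.chart s x + v ∈ affineSpan ℝ (Set.range fun p : s => T.chart s p) by simp [htop])
  rw [Finset.affineCombination_eq_linear_combination _ _ _ hl1] at hl
  refine ⟨fun p => (if h : p ∈ s then l ⟨p, h⟩ else 0) - if p = x then 1 else 0, ?_, ?_⟩
  · rw [Finset.sum_sub_distrib, Finset.sum_ite_eq' s x, if_pos hx, ← Finset.sum_coe_sort s, ← hl1]
    simp
  · simp only [sub_smul, ite_smul, one_smul, zero_smul]
    rw [Finset.sum_sub_distrib, Finset.sum_ite_eq' s x, if_pos hx, sub_eq_iff_eq_add',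
      hl, ← Finset.sum_coe_sort s]
    simp

/-! ### Convex combinations inside a simplex -/

/-- In the chart of the simplex `s`, the point `x` is the combination with positive weights `l` of
the points of `u`. -/
structure IsComb (s u : Finset P) (l : P → ℝ) (x : P) : Prop where
  face : s ∈ T.faces
  subset : (u : Set P) ⊆ T.carrier s
  mem : x ∈ T.carrier s
  pos : ∀ v ∈ u, 0 < l v
  sum_eq : ∑ v ∈ u, l v = 1
  sum_smul : ∑ v ∈ u, l v • T.chart s v = T.chart s x

variable {T} {s t u : Finset P} {l : P → ℝ} {x : P}

theorem IsComb.transfer (h : T.IsComb s u l x) (ht : t ∈ T.faces)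
    (hut : (u : Set P) ⊆ T.carrier t) (hxt : x ∈ T.carrier t) : T.IsComb t u l x where
  face := ht
  subset := hut
  mem := hxt
  pos := h.pos
  sum_eq := h.sum_eq
  sum_smul := by
    refine sum_smul_eq_of_dist_eq (p := T.chart s) (fun i hi j hj => ?_) h.sum_eq h.sum_smul
    have h1 : insert x (u : Set P) ⊆ T.carrier s := Set.insert_subset h.mem h.subset
    have h2 : insert x (u : Set P) ⊆ T.carrier t := Set.insert_subset hxt hut
    exact T.dist_chart_eq h.face ht (h1 hi) (h1 hj) (h2 hi) (h2 hj)

/-- A face of a simplex is extremal: if it contains an interior point of the convex hull of `u`, it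
contains all of `u`. -/
theorem IsComb.subset_carrier (h : T.IsComb s u l x) (ht : t ∈ T.faces) (hxt : x ∈ T.carrier t) :
    (u : Set P) ⊆ T.carrier t := by
  classical
  obtain ⟨hst, hx⟩ := T.mem_inter h.face ht h.mem hxt
  intro v hv
  refine T.carrier_mono t ht _ hst Finset.inter_subset_right ?_
  have hex : ∀ p : P, ∃ b : P → ℝ, p ∈ u → (∀ v ∈ s, 0 ≤ b v) ∧ ∑ v ∈ s, b v = 1 ∧
      ∑ v ∈ s, b v • T.chart s v = T.chart s p := by
    intro p
    by_cases hp : p ∈ u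
    · obtain ⟨b, hb⟩ := T.exists_weights h.face (h.subset hp)
      exact ⟨b, fun _ => hb⟩
    · exact ⟨0, fun h => absurd h hp⟩
  choose b hb using hex
  have h0 := T.weights_eq_zero h.face hst Finset.inter_subset_left hx
    (l := fun q => ∑ p ∈ u, l p * b p q) ?_ ?_
  · refine T.mem_carrier_of_weights h.face hst Finset.inter_subset_left (h.subset hv)
      (hb v hv).1 (hb v hv).2.1 (hb v hv).2.2 fun q hq hqt => ?_
    have := (Finset.sum_eq_zero_iff_of_nonneg (fun p hp =>
      mul_nonneg (h.pos p hp).le ((hb p hp).1 q hq))).1 (h0 q hq hqt) v hv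
    exact (mul_eq_zero.1 this).resolve_left (h.pos v hv).ne'
  · rw [Finset.sum_comm, ← h.sum_eq]
    refine Finset.sum_congr rfl fun p hp => ?_
    rw [← Finset.mul_sum, (hb p hp).2.1, mul_one]
  · rw [← h.sum_smul]
    simp only [Finset.sum_smul]
    rw [Finset.sum_comm]
    refine Finset.sum_congr rfl fun p hp => ?_
    rw [← (hb p hp).2.2, Finset.smul_sum]
    simp only [mul_smul]

theorem IsComb.of_mem (h : T.IsComb s u l x) (ht : t ∈ T.faces) (hxt : x ∈ T.carrier t) :
    T.IsComb t u l x :=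
  h.transfer ht (h.subset_carrier ht hxt) hxt

theorem IsComb.mem_carrier (h : T.IsComb s u l x) (ht : t ∈ T.faces)
    (hut : (u : Set P) ⊆ T.carrier t) : x ∈ T.carrier t := by
  classical
  have hne : u.Nonempty := by
    rw [Finset.nonempty_iff_ne_empty]
    rintro rfl
    simpa using h.sum_eq
  obtain ⟨v, hv⟩ := hne
  have hst := (T.mem_inter h.face ht (h.subset hv) (hut hv)).1
  have : T.chart s x ∈ T.chart s '' T.carrier (s ∩ t) := by
    rw [← h.sum_smul]
    refine (T.convex_image_carrier h.face hst Finset.inter_subset_left).sum_mem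
      (fun v hv => (h.pos v hv).le) h.sum_eq fun v hv => ?_
    exact ⟨v, (T.mem_inter h.face ht (h.subset hv) (hut hv)).2, rfl⟩
  obtain ⟨y, hy, hxy⟩ := this
  rw [← T.chart_injOn s h.face
    (T.carrier_mono s h.face _ hst Finset.inter_subset_left hy) h.mem hxy]
  exact T.carrier_mono t ht _ hst Finset.inter_subset_right hy

theorem IsComb.of_subset (h : T.IsComb s u l x) (ht : t ∈ T.faces)
    (hut : (u : Set P) ⊆ T.carrier t) : T.IsComb t u l x :=
  h.transfer ht hut (h.mem_carrier ht hut)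

variable (T) in
/-- A convex combination of points of a simplex, with those points dropped that have weight zero. -/
theorem exists_isComb (hs : s ∈ T.faces) (hu : (u : Set P) ⊆ T.carrier s)
    (hl : ∀ v ∈ u, 0 ≤ l v) (hl1 : ∑ v ∈ u, l v = 1) :
    ∃ x ∈ T.carrier s, T.chart s x = ∑ v ∈ u, l v • T.chart s v ∧
      T.IsComb s {v ∈ u | 0 < l v} l x := by
  have hz : ∀ v ∈ u, ¬ 0 < l v → l v = 0 := fun v hv h => le_antisymm (not_lt.1 h) (hl v hv)
  have : ∑ v ∈ u, l v • T.chart s v ∈ T.chart s '' T.carrier s :=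
    (T.convex_image_carrier hs hs subset_rfl).sum_mem hl hl1 fun v hv => ⟨v, hu hv, rfl⟩
  obtain ⟨x, hx, hxe⟩ := this
  refine ⟨x, hx, hxe, hs, fun v hv => hu (Finset.mem_filter.1 hv).1, hx,
    fun v hv => (Finset.mem_filter.1 hv).2, ?_, ?_⟩
  · rw [← hl1, Finset.sum_filter]
    refine Finset.sum_congr rfl fun v hv => ?_
    split_ifs with h
    · rfl
    · exact (hz v hv h).symm
  · rw [hxe, Finset.sum_filter]
    refine Finset.sum_congr rfl fun v hv => ?_
    split_ifs with h
    · rfl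
    · rw [hz v hv h, zero_smul]

end EuclideanTriangulation

namespace EuclideanTriangulation

/-! ### Subdivisions and the maps they carry -/

/-- A subdivision of `T` together with a candidate `φ` for the values at its vertices of a piecewise
distance preserving map: `F` is a finite abstract simplicial complex, each simplex of which is
spanned by points of one simplex of `T`; each point of `P` is in the interior of exactly one simplex
of `F`; and `φ` preserves the Euclidean distances between the vertices of each simplex. -/
structure IsSubdivision {n m : ℕ} {P : Type*} (T : EuclideanTriangulation n P)
    (F : Set (Finset P)) (φ : P → EuclideanSpace ℝ (Fin m)) : Prop where
  finite : F.Finite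
  nonempty : ∀ u ∈ F, u.Nonempty
  down_closed : ∀ u ∈ F, ∀ t : Finset P, t ⊆ u → t.Nonempty → t ∈ F
  exists_face : ∀ u ∈ F, ∃ s ∈ T.faces, (u : Set P) ⊆ T.carrier s
  exists_comb : ∀ x, ∃ u ∈ F, ∃ s l, T.IsComb s u l x
  unique_comb : ∀ {x u u' s s' l l'}, u ∈ F → u' ∈ F → T.IsComb s u l x →
    T.IsComb s' u' l' x → u = u'
  dist_eq : ∀ u ∈ F, ∀ s ∈ T.faces, (u : Set P) ⊆ T.carrier s → ∀ p ∈ u, ∀ q ∈ u,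
    dist (φ p) (φ q) = dist (T.chart s p) (T.chart s q)

namespace IsSubdivision

variable {n m : ℕ} {P : Type*} {T : EuclideanTriangulation n P} {F : Set (Finset P)}
  {φ : P → EuclideanSpace ℝ (Fin m)} (h : T.IsSubdivision F φ)

/-- The simplex of the subdivision whose interior contains a given point. -/
noncomputable def minFace (x : P) : Finset P := (h.exists_comb x).choose

theorem minFace_mem (x : P) : h.minFace x ∈ F := (h.exists_comb x).choose_spec.1

/-- The barycentric coordinates of a point in its minimal simplex. -/
noncomputable def weight (x : P) : P → ℝ := (h.exists_comb x).choose_spec.2.choose_spec.choose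

/-- A simplex of `T` that contains the minimal simplex of a given point. -/
noncomputable def base (x : P) : Finset P := (h.exists_comb x).choose_spec.2.choose

theorem isComb (x : P) : T.IsComb (h.base x) (h.minFace x) (h.weight x) x :=
  (h.exists_comb x).choose_spec.2.choose_spec.choose_spec

/-- The map which extends `φ` affinely over each simplex of the subdivision. -/
noncomputable def extend (x : P) : EuclideanSpace ℝ (Fin m) :=
  ∑ v ∈ h.minFace x, h.weight x v • φ v

theorem minFace_eq {x : P} {s u : Finset P} {l : P → ℝ} (hu : u ∈ F) (hx : T.IsComb s u l x) :
    h.minFace x = u :=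
  h.unique_comb (h.minFace_mem x) hu (h.isComb x) hx

theorem singleton_mem (h : T.IsSubdivision F φ) {u : Finset P} (hu : u ∈ F) {v : P} (hv : v ∈ u) : {v} ∈ F :=
  h.down_closed u hu _ (Finset.singleton_subset_iff.2 hv) (Finset.singleton_nonempty v)

theorem minFace_vertex {u : Finset P} (hu : u ∈ F) {v : P} (hv : v ∈ u) : h.minFace v = {v} := by
  obtain ⟨s, hs, hus⟩ := h.exists_face u hu
  refine h.minFace_eq (l := 1) (s := s) (h.singleton_mem hu hv) ⟨hs, ?_, hus hv, ?_, ?_, ?_⟩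
  · simpa using hus hv
  · simp
  · simp
  · simp

theorem extend_eq {x : P} {s u : Finset P} {l : P → ℝ} (hu : u ∈ F) (hx : T.IsComb s u l x) :
    h.extend x = ∑ v ∈ u, l v • φ v := by
  have he := h.minFace_eq hu hx
  have hc := h.isComb x
  rw [he] at hc
  replace hc := hc.of_mem hx.face hx.mem
  have h0 : ‖∑ v ∈ u, (h.weight x v - l v) • T.chart s v‖ = 0 := by
    simp only [sub_smul, Finset.sum_sub_distrib, hc.sum_smul, hx.sum_smul, sub_self, norm_zero]
  rw [← norm_sum_smul_eq_of_dist_eq (h.dist_eq u hu s hx.face hx.subset)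
    (by rw [Finset.sum_sub_distrib, hc.sum_eq, hx.sum_eq, sub_self]), norm_eq_zero] at h0
  simp only [sub_smul, Finset.sum_sub_distrib] at h0
  rw [extend, he]
  exact sub_eq_zero.1 h0

theorem extend_vertex {u : Finset P} (hu : u ∈ F) {v : P} (hv : v ∈ u) : h.extend v = φ v := by
  obtain ⟨s, hs, hus⟩ := h.exists_face u hu
  have : T.IsComb s {v} 1 v := ⟨hs, by simpa using hus hv, hus hv, by simp, by simp, by simp⟩
  rw [h.extend_eq (h.singleton_mem hu hv) this]
  simp

theorem mem_carrier {x : P} {s u : Finset P} (hs : s ∈ T.faces)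
    (hus : (u : Set P) ⊆ T.carrier s) (hx : h.minFace x ⊆ u) : x ∈ T.carrier s :=
  (h.isComb x).mem_carrier hs ((Finset.coe_subset.2 hx).trans hus)

/-- On a closed simplex of the subdivision the extended map preserves Euclidean distances. -/
theorem dist_extend {x y : P} {s u : Finset P} (hu : u ∈ F) (hs : s ∈ T.faces)
    (hus : (u : Set P) ⊆ T.carrier s) (hx : h.minFace x ⊆ u) (hy : h.minFace y ⊆ u) :
    dist (h.extend x) (h.extend y) = dist (T.chart s x) (T.chart s y) := by
  classical
  have key : ∀ z, h.minFace z ⊆ u → ∃ k : P → ℝ, ∑ v ∈ u, k v = 1 ∧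
      ∑ v ∈ u, k v • T.chart s v = T.chart s z ∧ ∑ v ∈ u, k v • φ v = h.extend z := by
    intro z hz
    have hc := (h.isComb z).of_mem hs (h.mem_carrier hs hus hz)
    refine ⟨fun v => if v ∈ h.minFace z then h.weight z v else 0, ?_, ?_, ?_⟩
    · rw [← Finset.sum_filter, Finset.filter_mem_eq_inter, Finset.inter_eq_right.2 hz, hc.sum_eq]
    · simp only [ite_smul, zero_smul]
      rw [← Finset.sum_filter, Finset.filter_mem_eq_inter, Finset.inter_eq_right.2 hz, hc.sum_smul]
    · simp only [ite_smul, zero_smul]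
      rw [← Finset.sum_filter, Finset.filter_mem_eq_inter, Finset.inter_eq_right.2 hz, extend]
  obtain ⟨k, hk1, hks, hke⟩ := key x hx
  obtain ⟨k', hk1', hks', hke'⟩ := key y hy
  rw [dist_eq_norm, dist_eq_norm, ← hks, ← hke, ← hks', ← hke', ← Finset.sum_sub_distrib,
    ← Finset.sum_sub_distrib]
  simp only [← sub_smul]
  exact norm_sum_smul_eq_of_dist_eq (h.dist_eq u hu s hs hus)
    (by rw [Finset.sum_sub_distrib, hk1, hk1', sub_self])

theorem extend_injOn {u : Finset P} (hu : u ∈ F) :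
    Set.InjOn h.extend {x | h.minFace x ⊆ u} := by
  obtain ⟨s, hs, hus⟩ := h.exists_face u hu
  intro x hx y hy hxy
  have := h.dist_extend hu hs hus hx hy
  rw [hxy, dist_self, eq_comm, dist_eq_zero] at this
  exact T.chart_injOn s hs (h.mem_carrier hs hus hx) (h.mem_carrier hs hus hy) this

theorem image_extend {u : Finset P} (hu : u ∈ F) :
    h.extend '' {x | h.minFace x ⊆ u} = convexHull ℝ (φ '' (u : Set P)) := by
  obtain ⟨s, hs, hus⟩ := h.exists_face u hu
  ext p
  constructor
  · rintro ⟨x, hx, rfl⟩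
    exact (convex_convexHull ℝ _).sum_mem (fun v hv => ((h.isComb x).pos v hv).le)
      (h.isComb x).sum_eq fun v hv => subset_convexHull ℝ _ ⟨v, hx hv, rfl⟩
  · intro hp
    obtain ⟨l, hl, hl1, rfl⟩ := mem_convexHull_image_finset.1 hp
    obtain ⟨x, hx, -, hc⟩ := T.exists_isComb hs hus hl hl1
    have hne : ({v ∈ u | 0 < l v} : Finset P).Nonempty := by
      rw [Finset.nonempty_iff_ne_empty]
      intro he
      have := hc.sum_eq
      rw [he] at this
      simp at this
    have hF := h.down_closed u hu _ (Finset.filter_subset _ u) hne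
    refine ⟨x, ?_, ?_⟩
    · rw [Set.mem_ofPred_eq, h.minFace_eq hF hc]
      exact Finset.filter_subset _ u
    · rw [h.extend_eq hF hc, Finset.sum_filter]
      refine Finset.sum_congr rfl fun v hv => ?_
      split_ifs with h0
      · rfl
      · rw [le_antisymm (not_lt.1 h0) (hl v hv), zero_smul]

/-- By Radon's theorem an affine dependence among the vertices of a simplex would produce a point in
the interiors of two disjoint faces. -/
theorem affineIndependent (h : T.IsSubdivision F φ) {u : Finset P} (hu : u ∈ F) :
    AffineIndependent ℝ (fun v : u => φ v) := by
  classical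
  by_contra hdep
  obtain ⟨I, p, hp1, hp2⟩ := Convex.radon_partition hdep
  have key : ∀ J : Set u, p ∈ convexHull ℝ ((fun v : u => φ v) '' J) →
      ∃ x, h.minFace x ⊆ u ∧ (∀ v ∈ h.minFace x, ∃ hv : v ∈ u, ⟨v, hv⟩ ∈ J) ∧ h.extend x = p := by
    intro J hJ
    set t : Finset P := u.filter fun v => ∃ hv : v ∈ u, (⟨v, hv⟩ : u) ∈ J with ht
    have him : (fun v : u => φ v) '' J = φ '' (t : Set P) := by
      ext q
      constructor
      · rintro ⟨v, hv, rfl⟩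
        exact ⟨v, by simpa [ht] using hv, rfl⟩
      · rintro ⟨v, hv, rfl⟩
        obtain ⟨-, hv, hvJ⟩ := Finset.mem_filter.1 hv
        exact ⟨⟨v, hv⟩, hvJ, rfl⟩
    rw [him] at hJ
    have hne : t.Nonempty := by
      have : (φ '' (t : Set P)).Nonempty := convexHull_nonempty_iff.1 ⟨p, hJ⟩
      simpa using this
    have htF := h.down_closed u hu t (Finset.filter_subset _ u) hne
    rw [← h.image_extend htF] at hJ
    obtain ⟨x, hx, rfl⟩ := hJ
    exact ⟨x, hx.trans (Finset.filter_subset _ u), fun v hv => (Finset.mem_filter.1 (hx hv)).2, rfl⟩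
  obtain ⟨x, hxu, hxI, hx⟩ := key I hp1
  obtain ⟨y, hyu, hyI, hy⟩ := key Iᶜ hp2
  obtain rfl := h.extend_injOn hu hxu hyu (hx.trans hy.symm)
  obtain ⟨v, hv⟩ := h.nonempty _ (h.minFace_mem x)
  obtain ⟨_, h1⟩ := hxI v hv
  obtain ⟨_, h2⟩ := hyI v hv
  exact h2 h1

/-- The subdivision as a triangulation. The extended map serves as the chart of every simplex. -/
noncomputable def triangulation : EuclideanTriangulation m P where
  faces := F
  carrier u := {x | h.minFace x ⊆ u}
  chart _ := h.extend
  finite_faces := h.finite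
  nonempty_of_mem := h.nonempty
  down_closed := h.down_closed
  vertices_subset u hu v hv := by
    rw [Set.mem_ofPred_eq, h.minFace_vertex hu hv]
    exact Finset.singleton_subset_iff.2 hv
  chart_injOn u hu := h.extend_injOn hu
  affineIndependent u hu := by
    have := h.affineIndependent hu
    have he : (fun v : u => h.extend v) = fun v : u => φ v :=
      funext fun v => h.extend_vertex hu v.2
    rw [he]
    exact this
  carrier_mono u hu t ht htu x hx := Finset.Subset.trans hx htu
  chart_image u hu t ht htu := by
    rw [h.image_extend ht, Set.image_congr fun v hv => h.extend_vertex ht hv]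
  dist_chart _ _ _ _ _ _ _ _ _ := rfl
  inter u hu t ht x hx := ⟨h.minFace x, h.minFace_mem x, hx.1, hx.2, Finset.Subset.refl _⟩
  cover x := ⟨h.minFace x, h.minFace_mem x, Finset.Subset.refl _⟩

/-- Straight segments covered by finitely many closed convex sets can be travelled along piece by
piece, each piece in one of the sets. Here `R p q L` says that `q` can be reached from `p` by a path
of length `L`. -/
theorem reach_of_segment_subset {V ι : Type*} [NormedAddCommGroup V] [NormedSpace ℝ V]
    (C : ι → Set V) (hC : ∀ i, IsClosed (C i)) (R : V → V → ℝ → Prop)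
    (hR0 : ∀ p, R p p 0)
    (hR : ∀ i p q r L, p ∈ C i → q ∈ C i → R q r L → R p r (dist p q + L)) (I : Finset ι) :
    ∀ p q : V, segment ℝ p q ⊆ ⋃ i ∈ I, C i → R p q (dist p q) := by
  classical
  induction I using Finset.strongInduction with
  | H I ih =>
    intro p q hpq
    obtain ⟨i, hi, hpi⟩ : ∃ i ∈ I, p ∈ C i := by
      simpa using hpq (left_mem_segment ℝ p q)
    set γ : ℝ → V := fun t => AffineMap.lineMap p q t with hγ
    have hγc : Continuous γ := AffineMap.lineMap_continuous
    have hγd : ∀ a b, dist (γ a) (γ b) = dist a b * dist p q := fun a b => dist_lineMap_lineMap p q a b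
    have hK : IsCompact (Set.Icc (0 : ℝ) 1 ∩ γ ⁻¹' C i) :=
      isCompact_Icc.inter_right ((hC i).preimage hγc)
    obtain ⟨t, ⟨ht, hti⟩, hmax⟩ := hK.exists_isGreatest ⟨0, by simp, by simpa [hγ] using hpi⟩
    have hlen : dist p q = dist p (γ t) + dist (γ t) q := by
      have h1 := hγd 0 t
      have h2 := hγd t 1
      simp only [hγ, AffineMap.lineMap_apply_zero, AffineMap.lineMap_apply_one] at h1 h2
      rw [hγ, h1, h2, Real.dist_eq, Real.dist_eq, zero_sub, abs_neg, abs_of_nonneg ht.1,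
        abs_sub_comm, abs_of_nonneg (sub_nonneg.2 ht.2)]
      ring
    rw [hlen]
    refine hR i _ _ _ _ hpi hti ?_
    rcases ht.2.eq_or_lt with rfl | ht1
    · simpa [hγ] using hR0 q
    refine ih (I.erase i) (Finset.erase_ssubset hi) _ _ ?_
    -- past the last point of `C i` the segment is covered by the other sets
    have hopen : ∀ a ∈ Set.Ioc t 1, γ a ∈ ⋃ j ∈ I.erase i, C j := by
      intro a ha
      have ha1 : a ∈ Set.Icc (0 : ℝ) 1 := ⟨ht.1.trans ha.1.le, ha.2⟩
      have : γ a ∈ ⋃ i ∈ I, C i := hpq (by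
        rw [segment_eq_image_lineMap]
        exact ⟨a, ha1, rfl⟩)
      simp only [Set.mem_iUnion] at this ⊢
      obtain ⟨j, hj, hja⟩ := this
      refine ⟨j, Finset.mem_erase.2 ⟨?_, hj⟩, hja⟩
      rintro rfl
      exact absurd (hmax ⟨ha1, hja⟩) (not_le.2 ha.1)
    have hclosed : IsClosed (γ ⁻¹' ⋃ j ∈ I.erase i, C j) :=
      (isClosed_biUnion_finset fun j _ => hC j).preimage hγc
    have hcl : Set.Icc t 1 ⊆ γ ⁻¹' ⋃ j ∈ I.erase i, C j := by
      rw [← closure_Ioc ht1.ne]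
      exact hclosed.closure_subset_iff.2 hopen
    rw [segment_eq_image_lineMap]
    rintro _ ⟨a, ha, rfl⟩
    have : AffineMap.lineMap (γ t) q a = γ (t + a * (1 - t)) := by
      simp only [hγ, AffineMap.lineMap_apply_module]
      module
    rw [this]
    refine hcl ⟨?_, ?_⟩
    · nlinarith [ha.1]
    · nlinarith [ha.2]

theorem brokenLine_trans {T : EuclideanTriangulation n P} {x y z : P} {L M : ℝ}
    (h1 : T.BrokenLine x y L) (h2 : T.BrokenLine y z M) : T.BrokenLine x z (L + M) := by
  induction h2 with
  | refl => simpa using h1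
  | step _ hs hy hz ih =>
    rw [← add_assoc]
    exact ih.step hs hy hz

theorem brokenLine_of_subdivision {x y : P} {L : ℝ} (hL : h.triangulation.BrokenLine x y L) :
    T.BrokenLine x y L := by
  induction hL with
  | refl => exact .refl _
  | @step y z L u _ hu hy hz ih =>
    obtain ⟨s, hs, hus⟩ := h.exists_face u hu
    have : dist (h.triangulation.chart u y) (h.triangulation.chart u z) =
        dist (T.chart s y) (T.chart s z) := h.dist_extend hu hs hus hy hz
    rw [this]
    exact ih.step hs (h.mem_carrier hs hus hy) (h.mem_carrier hs hus hz)

/-- A straight segment in a simplex of `T` is a broken line of the subdivision. -/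
theorem brokenLine_segment {s : Finset P} (hs : s ∈ T.faces) {x y : P} (hx : x ∈ T.carrier s)
    (hy : y ∈ T.carrier s) :
    h.triangulation.BrokenLine x y (dist (T.chart s x) (T.chart s y)) := by
  classical
  let ι := {u : Finset P // u ∈ F ∧ (u : Set P) ⊆ T.carrier s}
  have : Finite ι := (h.finite.subset fun u hu => hu.1).to_subtype
  have : Fintype ι := Fintype.ofFinite ι
  have key := reach_of_segment_subset
    (C := fun i : ι => convexHull ℝ (T.chart s '' (i.1 : Set P)))
    (fun i => ((i.1.finite_toSet.image _).isCompact_convexHull ℝ).isClosed)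
    (R := fun p q L => ∀ x ∈ T.carrier s, ∀ y ∈ T.carrier s, T.chart s x = p → T.chart s y = q →
      h.triangulation.BrokenLine x y L) ?_ ?_ Finset.univ (T.chart s x) (T.chart s y) ?_
  · exact key x hx y hy rfl rfl
  · rintro p x hx y hy rfl hyx
    rw [T.chart_injOn s hs hy hx hyx]
    exact .refl _
  · rintro ⟨u, hu, hus⟩ p q r L hp hq hL x hx y hy rfl rfl
    -- points of the hull of `u` are points of the closed simplex `u`
    have hull : ∀ p ∈ convexHull ℝ (T.chart s '' (u : Set P)),
        ∃ z ∈ T.carrier s, h.minFace z ⊆ u ∧ T.chart s z = p := by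
      intro p hp
      obtain ⟨l, hl, hl1, rfl⟩ := mem_convexHull_image_finset.1 hp
      obtain ⟨z, hz, hze, hc⟩ := T.exists_isComb hs hus hl hl1
      have hne : ({v ∈ u | 0 < l v} : Finset P).Nonempty := by
        rw [Finset.nonempty_iff_ne_empty]
        intro he
        have := hc.sum_eq
        rw [he] at this
        simp at this
      refine ⟨z, hz, ?_, hze⟩
      rw [h.minFace_eq (h.down_closed u hu _ (Finset.filter_subset _ u) hne) hc]
      exact Finset.filter_subset _ u
    obtain ⟨x', hx', hxu, hxe⟩ := hull _ hp
    obtain rfl := T.chart_injOn s hs hx' hx hxe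
    obtain ⟨z, hz, hzu, rfl⟩ := hull _ hq
    rw [← h.dist_extend hu hs hus hxu hzu]
    have h1 : h.triangulation.BrokenLine x' z (0 + dist (h.extend x') (h.extend z)) :=
      (BrokenLine.refl x').step (s := u) hu hxu hzu
    rw [zero_add] at h1
    exact brokenLine_trans h1 (hL z hz y hy rfl rfl)
  · intro p hp
    have : p ∈ T.chart s '' T.carrier s :=
      (T.convex_image_carrier hs hs subset_rfl).segment_subset ⟨x, hx, rfl⟩ ⟨y, hy, rfl⟩ hp
    obtain ⟨z, hz, rfl⟩ := this
    have hc := (h.isComb z).of_mem hs hz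
    simp only [Set.mem_iUnion]
    refine ⟨⟨h.minFace z, h.minFace_mem z, hc.subset⟩, Finset.mem_univ _, ?_⟩
    rw [mem_convexHull_image_finset]
    exact ⟨h.weight z, fun v hv => (hc.pos v hv).le, hc.sum_eq, hc.sum_smul⟩

theorem brokenLine_iff {x y : P} {L : ℝ} :
    h.triangulation.BrokenLine x y L ↔ T.BrokenLine x y L := by
  refine ⟨h.brokenLine_of_subdivision, fun hL => ?_⟩
  induction hL with
  | refl => exact .refl _
  | step _ hs hy hz ih => exact brokenLine_trans ih (h.brokenLine_segment hs hy hz)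

theorem dist_extend_le {x y : P} {L : ℝ} (hL : h.triangulation.BrokenLine x y L) :
    dist (h.extend x) (h.extend y) ≤ L := by
  induction hL with
  | refl => simp
  | step _ hs hy hz ih =>
    exact (dist_triangle _ _ _).trans (add_le_add_left ih _)

/-- The extended map is short, and on a simplex it preserves Euclidean distances; therefore the
distance in `P` of two points of a simplex is their Euclidean distance. -/
theorem isPiecewiseDistancePreserving [MetricSpace P] (hT : T.InducesMetric) :
    IsPiecewiseDistancePreserving h.extend := by
  have hind : h.triangulation.InducesMetric := by
    intro x y
    simpa only [h.brokenLine_iff] using hT x y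
  refine ⟨m, h.triangulation, hind, fun u hu x hx y hy => le_antisymm ?_ ?_⟩
  · exact (hind x y).2 fun L hL => h.dist_extend_le hL
  · have h1 : h.triangulation.BrokenLine x y (0 + dist (h.extend x) (h.extend y)) :=
      (BrokenLine.refl x).step (s := u) hu hx hy
    rw [zero_add] at h1
    exact (hind x y).1 h1

end IsSubdivision

end EuclideanTriangulation

/-! ### Nearest sites -/

/-- Stewart's theorem for a convex combination. -/
theorem dist_sq_convex_comb {V : Type*} [NormedAddCommGroup V] [InnerProductSpace ℝ V]
    (x y p : V) {a b : ℝ} (hab : a + b = 1) :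
    dist (a • x + b • y) p ^ 2 = a * dist x p ^ 2 + b * dist y p ^ 2 - a * b * dist x y ^ 2 := by
  obtain rfl : b = 1 - a := by linarith
  have h1 : a • x + (1 - a) • y - p = a • (x - p) + (1 - a) • (y - p) := by module
  have h2 : x - y = (x - p) - (y - p) := by abel
  rw [dist_eq_norm, dist_eq_norm, dist_eq_norm, dist_eq_norm, h1, h2, norm_add_sq_real,
    norm_sub_sq_real (x - p) (y - p), norm_smul, norm_smul, inner_smul_left, inner_smul_right, mul_pow, mul_pow]
  simp only [Real.norm_eq_abs, sq_abs, conj_trivial]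
  ring

theorem inner_sub_sub_eq_zero_of_dist_eq {V : Type*} [NormedAddCommGroup V]
    [InnerProductSpace ℝ V] {x y p q : V} (hx : dist x p = dist x q) (hy : dist y p = dist y q) :
    inner ℝ (x - y) (p - q) = 0 := by
  have h : ∀ z : V, dist z p = dist z q → 2 * inner ℝ z (p - q) = ‖p‖ ^ 2 - ‖q‖ ^ 2 := by
    intro z hz
    have : ‖z - p‖ ^ 2 = ‖z - q‖ ^ 2 := by rw [← dist_eq_norm, ← dist_eq_norm, hz]
    rw [norm_sub_sq_real, norm_sub_sq_real] at this
    rw [inner_sub_right]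
    linarith
  rw [inner_sub_left]
  linarith [h x hx, h y hy]

theorem dist_add_smul_eq {V : Type*} [NormedAddCommGroup V] [InnerProductSpace ℝ V]
    {x p q v : V} (hx : dist x p = dist x q) (hv : inner ℝ v (p - q) = 0) (t : ℝ) :
    dist (x + t • v) p = dist (x + t • v) q := by
  have h : ∀ r : V, dist (x + t • v) r ^ 2 =
      dist x r ^ 2 + 2 * t * (inner ℝ v x - inner ℝ v r) + t ^ 2 * ‖v‖ ^ 2 := by
    intro r
    rw [dist_eq_norm, dist_eq_norm, show x + t • v - r = (x - r) + t • v by abel, norm_add_sq_real,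
      inner_smul_right, real_inner_comm, inner_sub_right, norm_smul, mul_pow, Real.norm_eq_abs,
      sq_abs]
    ring
  have hpq : inner ℝ v p = inner ℝ v q := by
    rw [inner_sub_right] at hv
    linarith
  refine (pow_left_inj₀ dist_nonneg dist_nonneg two_ne_zero).1 ?_
  rw [h, h, hx, hpq]

/-- In the plane, points equidistant from two distinct points are collinear. -/
theorem collinear_of_dist_eq {p q : EuclideanSpace ℝ (Fin 2)} (hpq : p ≠ q)
    {S : Set (EuclideanSpace ℝ (Fin 2))} (hS : ∀ x ∈ S, dist x p = dist x q) :
    Collinear ℝ S := by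
  rcases S.eq_empty_or_nonempty with rfl | ⟨x, hx⟩
  · exact collinear_empty ℝ _
  have : Fact (Module.finrank ℝ (EuclideanSpace ℝ (Fin 2)) = 1 + 1) := ⟨by simp⟩
  obtain ⟨v, -, hv⟩ := finrank_eq_one_iff'.1
    (Submodule.finrank_orthogonal_span_singleton (𝕜 := ℝ) (sub_ne_zero.2 hpq))
  rw [collinear_iff_of_mem hx]
  refine ⟨v, fun y hy => ?_⟩
  obtain ⟨c, hc⟩ := hv ⟨y - x, by
    rw [Submodule.mem_orthogonal_singleton_iff_inner_left]
    exact inner_sub_sub_eq_zero_of_dist_eq (hS y hy) (hS x hx)⟩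
  refine ⟨c, ?_⟩
  have := congrArg Subtype.val hc
  simp only [Submodule.coe_smul] at this
  rw [this]
  simp

namespace EuclideanTriangulation

variable {P : Type*}

/-- A finite set `W` of sites, containing all vertices, such that among the sites of a simplex those
nearest to a point of a face lie on that face. Then the Voronoi diagrams of the simplices,
each taken with respect to the sites on it, agree on common faces. -/
structure IsSites (T : EuclideanTriangulation 2 P) (W : Set P) : Prop where
  finite : W.Finite
  vertex_mem : ∀ s ∈ T.faces, ∀ v ∈ s, v ∈ W
  nearest_mem : ∀ s ∈ T.faces, ∀ t ∈ T.faces, t ⊆ s → ∀ x ∈ T.carrier t, ∀ w ∈ W,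
    w ∈ T.carrier s → (∀ w' ∈ W, w' ∈ T.carrier s →
      dist (T.chart s x) (T.chart s w) ≤ dist (T.chart s x) (T.chart s w')) → w ∈ T.carrier t

/-- The sites nearest to `x` in the minimal simplex of `x`. -/
def near (T : EuclideanTriangulation 2 P) (W : Set P) (x : P) : Set P :=
  {w | w ∈ W ∧ w ∈ T.carrier (T.supp x) ∧ ∀ w' ∈ W, w' ∈ T.carrier (T.supp x) →
    dist (T.chart (T.supp x) x) (T.chart (T.supp x) w) ≤
      dist (T.chart (T.supp x) x) (T.chart (T.supp x) w')}

namespace IsSites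

variable {T : EuclideanTriangulation 2 P} {W : Set P} {s : Finset P}
  {x y z w w' : P}

theorem exists_nearest (h : T.IsSites W) (hs : s ∈ T.faces) (x : P) :
    ∃ w ∈ W, w ∈ T.carrier s ∧ ∀ w' ∈ W, w' ∈ T.carrier s →
      dist (T.chart s x) (T.chart s w) ≤ dist (T.chart s x) (T.chart s w') := by
  obtain ⟨v, hv⟩ := T.nonempty_of_mem s hs
  obtain ⟨w, hw, hmin⟩ := (W ∩ T.carrier s).exists_min_image
    (fun w => dist (T.chart s x) (T.chart s w)) (h.finite.subset Set.inter_subset_left)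
    ⟨v, h.vertex_mem s hs v hv, T.vertices_subset s hs hv⟩
  exact ⟨w, hw.1, hw.2, fun w' h1 h2 => hmin w' ⟨h1, h2⟩⟩

/-- The nearest sites may be computed in any simplex that contains the point. -/
theorem mem_near_iff (h : T.IsSites W) (hs : s ∈ T.faces) (hx : x ∈ T.carrier s) :
    w ∈ T.near W x ↔ w ∈ W ∧ w ∈ T.carrier s ∧ ∀ w' ∈ W, w' ∈ T.carrier s →
      dist (T.chart s x) (T.chart s w) ≤ dist (T.chart s x) (T.chart s w') := by
  have ht := T.supp_mem x
  have hxt := T.mem_carrier_supp x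
  have hts := T.supp_subset hs hx
  have hc := T.carrier_mono s hs _ ht hts
  constructor
  · rintro ⟨hw, hwt, hmin⟩
    refine ⟨hw, hc hwt, fun w' hw' hws' => ?_⟩
    obtain ⟨w0, hw0, hw0s, hmin0⟩ := h.exists_nearest hs x
    have hw0t := h.nearest_mem s hs _ ht hts x hxt w0 hw0 hw0s hmin0
    refine le_trans ?_ (hmin0 w' hw' hws')
    rw [← T.dist_chart s hs _ ht hts x hxt w hwt, ← T.dist_chart s hs _ ht hts x hxt w0 hw0t]
    exact hmin w0 hw0 hw0t
  · rintro ⟨hw, hws, hmin⟩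
    have hwt := h.nearest_mem s hs _ ht hts x hxt w hw hws hmin
    refine ⟨hw, hwt, fun w' hw' hwt' => ?_⟩
    rw [T.dist_chart s hs _ ht hts x hxt w hwt, T.dist_chart s hs _ ht hts x hxt w' hwt']
    exact hmin w' hw' (hc hwt')

theorem near_nonempty (h : T.IsSites W) (x : P) : (T.near W x).Nonempty := by
  obtain ⟨w, h1, h2, h3⟩ := h.exists_nearest (T.supp_mem x) x
  exact ⟨w, h1, h2, h3⟩

theorem mem_carrier_of_near (h : T.IsSites W) (hs : s ∈ T.faces) (hx : x ∈ T.carrier s)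
    (hw : w ∈ T.near W x) : w ∈ T.carrier s :=
  ((h.mem_near_iff hs hx).1 hw).2.1

theorem dist_eq_of_near (h : T.IsSites W) (hs : s ∈ T.faces) (hx : x ∈ T.carrier s)
    (hw : w ∈ T.near W x) (hw' : w' ∈ T.near W x) :
    dist (T.chart s x) (T.chart s w) = dist (T.chart s x) (T.chart s w') := by
  have h1 := (h.mem_near_iff hs hx).1 hw
  have h2 := (h.mem_near_iff hs hx).1 hw'
  exact le_antisymm (h1.2.2 w' h2.1 h2.2.1) (h2.2.2 w h1.1 h1.2.1)

theorem near_site (h : T.IsSites W) (hx : x ∈ W) : T.near W x = {x} := by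
  have hs := T.supp_mem x
  have hxs := T.mem_carrier_supp x
  have hxx : x ∈ T.near W x := ⟨hx, hxs, fun w' _ _ => by simp⟩
  refine Set.eq_singleton_iff_unique_mem.2 ⟨hxx, fun w hw => ?_⟩
  have := h.dist_eq_of_near hs hxs hw hxx
  rw [dist_self, dist_eq_zero] at this
  exact (T.chart_injOn _ hs hxs hw.2.1 this).symm

/-- Comparison of the distances to two sites is affine in the point; so the sites nearest to an
interior point of a segment are those nearest to both ends, once there is one. -/
theorem near_between (h : T.IsSites W) (hs : s ∈ T.faces) (hx : x ∈ T.carrier s)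
    (hy : y ∈ T.carrier s) (hz : z ∈ T.carrier s) {a b : ℝ} (ha : 0 < a) (hb : 0 < b)
    (hab : a + b = 1) (he : a • T.chart s x + b • T.chart s y = T.chart s z)
    (hwx : w ∈ T.near W x) (hwy : w ∈ T.near W y) :
    T.near W z = T.near W x ∩ T.near W y := by
  have hst : ∀ p, dist (T.chart s z) (T.chart s p) ^ 2 =
      a * dist (T.chart s x) (T.chart s p) ^ 2 + b * dist (T.chart s y) (T.chart s p) ^ 2 -
        a * b * dist (T.chart s x) (T.chart s y) ^ 2 := fun p => by
    rw [← he, dist_sq_convex_comb _ _ _ hab]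
  have hx' := (h.mem_near_iff hs hx).1 hwx
  have hy' := (h.mem_near_iff hs hy).1 hwy
  have hwz : w ∈ T.near W z := by
    refine (h.mem_near_iff hs hz).2 ⟨hx'.1, hx'.2.1, fun p hp hps => ?_⟩
    refine (pow_le_pow_iff_left₀ dist_nonneg dist_nonneg two_ne_zero).1 ?_
    rw [hst, hst]
    have h1 := pow_le_pow_left₀ dist_nonneg (hx'.2.2 p hp hps) 2
    have h2 := pow_le_pow_left₀ dist_nonneg (hy'.2.2 p hp hps) 2
    gcongr
  have hz' := (h.mem_near_iff hs hz).1 hwz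
  ext p
  constructor
  · intro hp
    obtain ⟨hpW, hps, -⟩ := (h.mem_near_iff hs hz).1 hp
    have hd := h.dist_eq_of_near hs hz hp hwz
    have h0 : dist (T.chart s z) (T.chart s p) ^ 2 = dist (T.chart s z) (T.chart s w) ^ 2 := by
      rw [hd]
    rw [hst, hst] at h0
    have h1 := pow_le_pow_left₀ dist_nonneg (hx'.2.2 p hpW hps) 2
    have h2 := pow_le_pow_left₀ dist_nonneg (hy'.2.2 p hpW hps) 2
    have e1 : dist (T.chart s x) (T.chart s p) ≤ dist (T.chart s x) (T.chart s w) :=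
      (pow_le_pow_iff_left₀ dist_nonneg dist_nonneg two_ne_zero).1 (by nlinarith)
    have e2 : dist (T.chart s y) (T.chart s p) ≤ dist (T.chart s y) (T.chart s w) :=
      (pow_le_pow_iff_left₀ dist_nonneg dist_nonneg two_ne_zero).1 (by nlinarith)
    exact ⟨(h.mem_near_iff hs hx).2 ⟨hpW, hps, fun q hq hqs => e1.trans (hx'.2.2 q hq hqs)⟩,
      (h.mem_near_iff hs hy).2 ⟨hpW, hps, fun q hq hqs => e2.trans (hy'.2.2 q hq hqs)⟩⟩
  · rintro ⟨hpx, hpy⟩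
    obtain ⟨hpW, hps, -⟩ := (h.mem_near_iff hs hx).1 hpx
    refine (h.mem_near_iff hs hz).2 ⟨hpW, hps, fun q hq hqs => ?_⟩
    refine le_trans (le_of_eq ?_) (hz'.2.2 q hq hqs)
    refine (pow_left_inj₀ dist_nonneg dist_nonneg two_ne_zero).1 ?_
    rw [hst, hst, h.dist_eq_of_near hs hx hpx hwx, h.dist_eq_of_near hs hy hpy hwy]

/-- From a point `x` one may run in the direction `v` as long as the simplex is not left and the
sites of `N` remain nearest. At the last point there is a further nearest site, unless the simplex
is left there. -/
theorem exists_exit (h : T.IsSites W) (hs : s ∈ T.faces) (hx : x ∈ T.carrier s)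
    {v : EuclideanSpace ℝ (Fin 2)} (hv : v ≠ 0) {N : Set P} (hN : N ⊆ T.near W x)
    (hne : N.Nonempty) (horth : ∀ w ∈ N, ∀ w' ∈ N, inner ℝ v (T.chart s w - T.chart s w') = 0) :
    ∃ t : ℝ, 0 ≤ t ∧ ∃ y ∈ T.carrier s, T.chart s y = T.chart s x + t • v ∧ N ⊆ T.near W y ∧
      ((∀ᶠ δ : ℝ in nhdsWithin 0 (Set.Ioi 0),
        T.chart s y + δ • v ∈ convexHull ℝ (T.chart s '' (s : Set P))) → ¬ T.near W y ⊆ N) := by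
  classical
  set γ : ℝ → EuclideanSpace ℝ (Fin 2) := fun t => T.chart s x + t • v with hγ
  have hγc : Continuous γ := by fun_prop
  set H := convexHull ℝ (T.chart s '' (s : Set P)) with hH
  have hHc : IsCompact H := (s.finite_toSet.image _).isCompact_convexHull ℝ
  set K : Set ℝ := {t | 0 ≤ t ∧ γ t ∈ H ∧ ∀ w ∈ N, ∀ w' ∈ W, w' ∈ T.carrier s →
    dist (γ t) (T.chart s w) ≤ dist (γ t) (T.chart s w')} with hK
  have hKcl : IsClosed K := by
    have : K = Set.Ici 0 ∩ γ ⁻¹' H ∩ ⋂ w ∈ N, ⋂ w' ∈ W, ⋂ (_ : w' ∈ T.carrier s),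
        {t | dist (γ t) (T.chart s w) ≤ dist (γ t) (T.chart s w')} := by
      ext t
      simp [hK, and_assoc]
    rw [this]
    refine (isClosed_Ici.inter (hHc.isClosed.preimage hγc)).inter ?_
    refine isClosed_biInter fun w _ => isClosed_biInter fun w' _ => isClosed_iInter fun _ => ?_
    exact isClosed_le (hγc.dist continuous_const) (hγc.dist continuous_const)
  have hKb : Bornology.IsBounded K := by
    obtain ⟨R, hR⟩ := hHc.isBounded.subset_closedBall (T.chart s x)
    refine (Metric.isBounded_Icc 0 (R / ‖v‖)).subset fun t ht => ⟨ht.1, ?_⟩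
    have h1 := hR ht.2.1
    rw [Metric.mem_closedBall, hγ, dist_eq_norm, add_sub_cancel_left, norm_smul,
      Real.norm_eq_abs, abs_of_nonneg ht.1] at h1
    rwa [le_div_iff₀ (norm_pos_iff.2 hv)]
  have hK0 : (0 : ℝ) ∈ K := by
    refine ⟨le_rfl, ?_, fun w hw w' hw' hws' => ?_⟩
    · rw [hH, ← T.image_carrier hs]
      exact ⟨x, hx, by simp [hγ]⟩
    · simpa [hγ] using ((h.mem_near_iff hs hx).1 (hN hw)).2.2 w' hw' hws'
  obtain ⟨t, ht, hmax⟩ := (Metric.isCompact_of_isClosed_isBounded hKcl hKb).exists_isGreatest ⟨0, hK0⟩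
  have hyH := ht.2.1
  rw [hH, ← T.image_carrier hs] at hyH
  obtain ⟨y, hy, hye⟩ := hyH
  have hNy : N ⊆ T.near W y := fun w hw => by
    have := (h.mem_near_iff hs hx).1 (hN hw)
    refine (h.mem_near_iff hs hy).2 ⟨this.1, this.2.1, fun w' hw' hws' => ?_⟩
    rw [hye]
    exact ht.2.2 w hw w' hw' hws'
  refine ⟨t, ht.1, y, hy, hye, hNy, fun hev hsub => ?_⟩
  -- the other sites stay strictly farther for a while, so `t` would not be maximal
  obtain ⟨w0, hw0⟩ := hne
  have hfar : ∀ᶠ δ : ℝ in nhds 0, ∀ w' ∈ W ∩ T.carrier s, w' ∉ N →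
      dist (T.chart s y + δ • v) (T.chart s w0) < dist (T.chart s y + δ • v) (T.chart s w') := by
    rw [Filter.eventually_all_finite (h.finite.subset Set.inter_subset_left)]
    rintro w' ⟨hw', hws'⟩
    by_cases hwN : w' ∈ N
    · exact Filter.Eventually.of_forall fun _ h' => absurd hwN h'
    have hlt : dist (T.chart s y) (T.chart s w0) < dist (T.chart s y) (T.chart s w') := by
      have h0 := (h.mem_near_iff hs hy).1 (hNy hw0)
      refine lt_of_not_ge fun hle => hwN (hsub ?_)
      exact (h.mem_near_iff hs hy).2 ⟨hw', hws', fun q hq hqs => hle.trans (h0.2.2 q hq hqs)⟩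
    have hc1 : Continuous fun δ : ℝ => dist (T.chart s y + δ • v) (T.chart s w0) := by fun_prop
    have hc2 : Continuous fun δ : ℝ => dist (T.chart s y + δ • v) (T.chart s w') := by fun_prop
    have := (hc1.tendsto 0).eventually_lt (hc2.tendsto 0) (by simpa using hlt)
    exact this.mono fun _ h' _ => h'
  obtain ⟨δ, ⟨hδ1, hδ2⟩, hδ0⟩ := ((hev.and (hfar.filter_mono nhdsWithin_le_nhds)).and
    self_mem_nhdsWithin).exists
  have hγδ : γ (t + δ) = T.chart s y + δ • v := by
    rw [hye]
    simp only [hγ]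
    module
  have hmem : t + δ ∈ K := by
    refine ⟨add_nonneg ht.1 (le_of_lt hδ0), by rwa [hγδ], fun w hw w' hw' hws' => ?_⟩
    rw [hγδ]
    have heq : ∀ q ∈ N, dist (T.chart s y + δ • v) (T.chart s w) =
        dist (T.chart s y + δ • v) (T.chart s q) := fun q hq =>
      dist_add_smul_eq (h.dist_eq_of_near hs hy (hNy hw) (hNy hq)) (horth w hw q hq) δ
    by_cases hwN : w' ∈ N
    · exact (heq w' hwN).le
    · rw [heq w0 hw0]
      exact (hδ2 w' ⟨hw', hws'⟩ hwN).le
  have := hmax hmem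
  have : (0 : ℝ) < δ := hδ0
  linarith

end IsSites

end EuclideanTriangulation

namespace EuclideanTriangulation

variable {P : Type*}

/-! ### The cut locus of the sites -/

/-- A node: a point with at least two nearest sites, which is not an interior point of an edge of
the Voronoi diagram of a triangle. -/
def IsNode (T : EuclideanTriangulation 2 P) (W : Set P) (x : P) : Prop :=
  (T.near W x).Nontrivial ∧ ((T.supp x).card = 3 → ∀ w w', T.near W x ≠ {w, w'})

open Classical in
/-- The distance from `x` to its nearest sites. -/
noncomputable def radius (T : EuclideanTriangulation 2 P) (W : Set P) (x : P) : ℝ :=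
  if h : (T.near W x).Nonempty then dist (T.chart (T.supp x) x) (T.chart (T.supp x) h.some) else 0

/-- `m` is the chosen point on the edge with ends `a`, `b` of the Voronoi diagram of the triangle
`s`. It divides the edge in the ratio of the radii of the ends, that is, the segments from the two
sites of the edge to `m` bisect the angles under which these sites see the edge. -/
structure IsBisector (T : EuclideanTriangulation 2 P) (W : Set P) (s : Finset P) (a b m : P) :
    Prop where
  face : s ∈ T.faces
  left_mem : a ∈ T.carrier s
  right_mem : b ∈ T.carrier s
  mem : m ∈ T.carrier s
  left_node : T.IsNode W a
  right_node : T.IsNode W b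
  ne : a ≠ b
  common : (T.near W a ∩ T.near W b).Nontrivial
  eq : (T.radius W b / (T.radius W a + T.radius W b)) • T.chart s a +
    (T.radius W a / (T.radius W a + T.radius W b)) • T.chart s b = T.chart s m

namespace IsSites

variable {T : EuclideanTriangulation 2 P} {W : Set P} {s t : Finset P}
  {a b m x y z w w' : P}

theorem radius_eq (h : T.IsSites W) (hs : s ∈ T.faces) (hx : x ∈ T.carrier s)
    (hw : w ∈ T.near W x) : dist (T.chart s x) (T.chart s w) = T.radius W x := by
  have hne : (T.near W x).Nonempty := ⟨w, hw⟩
  rw [radius, dif_pos hne]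
  have ht := T.supp_mem x
  have hxt := T.mem_carrier_supp x
  rw [h.dist_eq_of_near hs hx hw hne.some_mem]
  exact T.dist_chart_eq hs ht hx (h.mem_carrier_of_near hs hx hne.some_mem) hxt
    (h.mem_carrier_of_near ht hxt hne.some_mem)

theorem radius_pos (h : T.IsSites W) (hx : (T.near W x).Nontrivial) : 0 < T.radius W x := by
  obtain ⟨w, hw, w', hw', hne⟩ := hx
  have ht := T.supp_mem x
  have hxt := T.mem_carrier_supp x
  have h1 := h.radius_eq ht hxt hw
  have h2 := h.radius_eq ht hxt hw'
  refine lt_of_le_of_ne (h1 ▸ dist_nonneg) fun h0 => hne ?_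
  rw [← h0, dist_eq_zero] at h1 h2
  exact T.chart_injOn _ ht (h.mem_carrier_of_near ht hxt hw) (h.mem_carrier_of_near ht hxt hw')
    (h1.symm.trans h2)

theorem not_mem_of_nontrivial (h : T.IsSites W) (hx : (T.near W x).Nontrivial) : x ∉ W := by
  intro hW
  rw [h.near_site hW] at hx
  exact Set.not_nontrivial_singleton hx

/-- In a simplex of dimension at most one, no two points are equidistant from the same two
points. -/
theorem eq_or_eq_of_card_le_two {T : EuclideanTriangulation 2 P} (ht : t ∈ T.faces)
    (hcard : t.card ≤ 2) (hx : x ∈ T.carrier t) (hy : y ∈ T.carrier t) (hw : w ∈ T.carrier t)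
    (hw' : w' ∈ T.carrier t)
    (hdx : dist (T.chart t x) (T.chart t w) = dist (T.chart t x) (T.chart t w'))
    (hdy : dist (T.chart t y) (T.chart t w) = dist (T.chart t y) (T.chart t w')) :
    x = y ∨ w = w' := by
  classical
  obtain ⟨p, q, hpq⟩ : ∃ p q, t ⊆ {p, q} := by
    obtain ⟨p, hp⟩ := T.nonempty_of_mem t ht
    have hcard' : (t.erase p).card ≤ 1 := by
      rw [Finset.card_erase_of_mem hp]
      omega
    have : Nonempty P := ⟨p⟩
    rw [Finset.card_le_one_iff_subset_singleton] at hcard'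
    obtain ⟨q, hq⟩ := hcard'
    refine ⟨p, q, fun v hv => ?_⟩
    by_cases hvp : v = p
    · simp [hvp]
    · have := hq (Finset.mem_erase.2 ⟨hvp, hv⟩)
      simp only [Finset.mem_singleton] at this
      simp [this]
  have hline : ∀ z ∈ T.carrier t, ∃ c : ℝ,
      T.chart t z = T.chart t p + c • (T.chart t q - T.chart t p) := by
    intro z hz
    have hz' : T.chart t z ∈ convexHull ℝ (T.chart t '' (t : Set P)) := by
      rw [← T.image_carrier ht]
      exact ⟨z, hz, rfl⟩
    have hsub : T.chart t '' (t : Set P) ⊆ {T.chart t p, T.chart t q} := by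
      rintro _ ⟨v, hv, rfl⟩
      have := hpq hv
      simp only [Finset.mem_insert, Finset.mem_singleton] at this
      rcases this with rfl | rfl <;> simp
    have := convexHull_mono hsub hz'
    rw [convexHull_pair, segment_eq_image'] at this
    obtain ⟨c, -, hc⟩ := this
    exact ⟨c, hc.symm⟩
  have h0 := inner_sub_sub_eq_zero_of_dist_eq hdx hdy
  obtain ⟨cx, hcx⟩ := hline x hx
  obtain ⟨cy, hcy⟩ := hline y hy
  obtain ⟨cw, hcw⟩ := hline w hw
  obtain ⟨cw', hcw'⟩ := hline w' hw'
  have e1 : T.chart t x - T.chart t y = (cx - cy) • (T.chart t q - T.chart t p) := by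
    rw [hcx, hcy]; module
  have e2 : T.chart t w - T.chart t w' = (cw - cw') • (T.chart t q - T.chart t p) := by
    rw [hcw, hcw']; module
  rw [e1, e2, inner_smul_left, inner_smul_right] at h0
  rcases mul_eq_zero.1 h0 with h1 | h1
  · left
    refine T.chart_injOn t ht hx hy (sub_eq_zero.1 ?_)
    rw [e1, show cx - cy = 0 by simpa using h1, zero_smul]
  · rcases mul_eq_zero.1 h1 with h2 | h2
    · right
      refine T.chart_injOn t ht hw hw' (sub_eq_zero.1 ?_)
      rw [e2, h2, zero_smul]
    · left
      refine T.chart_injOn t ht hx hy (sub_eq_zero.1 ?_)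
      rw [e1, inner_self_eq_zero.1 h2, smul_zero]

theorem isComb_pair {T : EuclideanTriangulation 2 P} [DecidableEq P] (hs : s ∈ T.faces)
    (hx : x ∈ T.carrier s) (hy : y ∈ T.carrier s) (hz : z ∈ T.carrier s) (hxy : x ≠ y) {α β : ℝ}
    (hα : 0 < α) (hβ : 0 < β) (hab : α + β = 1)
    (he : α • T.chart s x + β • T.chart s y = T.chart s z) :
    T.IsComb s {x, y} (fun p => if p = x then α else β) z where
  face := hs
  subset := by
    intro p hp
    simp only [Finset.coe_insert, Finset.coe_singleton, Set.mem_insert_iff,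
      Set.mem_singleton_iff] at hp
    rcases hp with rfl | rfl <;> assumption
  mem := hz
  pos p _ := by split_ifs <;> assumption
  sum_eq := by rw [Finset.sum_pair hxy, if_pos rfl, if_neg hxy.symm, hab]
  sum_smul := by rw [Finset.sum_pair hxy, if_pos rfl, if_neg hxy.symm, he]

/-- Between two points with two common nearest sites there are only interior points of an edge of
the Voronoi diagram of a triangle. -/
theorem near_eq_pair_of_between (h : T.IsSites W) (hs : s ∈ T.faces) (hx : x ∈ T.carrier s)
    (hy : y ∈ T.carrier s) (hz : z ∈ T.carrier s) (hxy : x ≠ y) {α β : ℝ} (hα : 0 < α)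
    (hβ : 0 < β) (hab : α + β = 1) (he : α • T.chart s x + β • T.chart s y = T.chart s z)
    (hww : w ≠ w') (hwx : w ∈ T.near W x) (hwy : w ∈ T.near W y) (hwx' : w' ∈ T.near W x)
    (hwy' : w' ∈ T.near W y) :
    T.near W z = {w, w'} ∧ T.near W x ∩ T.near W y = {w, w'} ∧ (T.supp z).card = 3 := by
  classical
  have hnz := h.near_between hs hx hy hz hα hβ hab he hwx hwy
  have hinter : T.near W x ∩ T.near W y = {w, w'} := by
    refine Set.Subset.antisymm ?_ ?_
    · rintro v ⟨hvx, hvy⟩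
      have hm : ∀ {u}, u ∈ T.near W x → u ∈ T.carrier s := h.mem_carrier_of_near hs hx
      have := EuclideanGeometry.eq_of_dist_eq_of_dist_eq_of_finrank_eq_two
        (c₁ := T.chart s x) (c₂ := T.chart s y) (p₁ := T.chart s w) (p₂ := T.chart s w')
        (p := T.chart s v) (r₁ := T.radius W x) (r₂ := T.radius W y) (by simp)
        (fun h0 => hxy (T.chart_injOn s hs hx hy h0))
        (fun h0 => hww (T.chart_injOn s hs (hm hwx) (hm hwx') h0))
        (by rw [dist_comm]; exact h.radius_eq hs hx hwx)
        (by rw [dist_comm]; exact h.radius_eq hs hx hwx')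
        (by rw [dist_comm]; exact h.radius_eq hs hx hvx)
        (by rw [dist_comm]; exact h.radius_eq hs hy hwy)
        (by rw [dist_comm]; exact h.radius_eq hs hy hwy')
        (by rw [dist_comm]; exact h.radius_eq hs hy hvy)
      rcases this with h0 | h0
      · exact Or.inl (T.chart_injOn s hs (hm hvx) (hm hwx) h0)
      · exact Or.inr (T.chart_injOn s hs (hm hvx) (hm hwx') h0)
    · rintro v (rfl | rfl)
      · exact ⟨hwx, hwy⟩
      · exact ⟨hwx', hwy'⟩
  refine ⟨hnz.trans hinter, hinter, ?_⟩
  have ht := T.supp_mem z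
  refine le_antisymm (T.card_le ht) (not_lt.1 fun hlt => ?_)
  have hsub := (isComb_pair hs hx hy hz hxy hα hβ hab he).subset_carrier ht (T.mem_carrier_supp z)
  have hxt : x ∈ T.carrier (T.supp z) := hsub (by simp)
  have hyt : y ∈ T.carrier (T.supp z) := hsub (by simp)
  rcases eq_or_eq_of_card_le_two ht (Nat.lt_succ_iff.1 hlt) hxt hyt
    (h.mem_carrier_of_near ht hxt hwx) (h.mem_carrier_of_near ht hxt hwx')
    (h.dist_eq_of_near ht hxt hwx hwx') (h.dist_eq_of_near ht hyt hwy hwy') with h0 | h0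
  · exact hxy h0
  · exact hww h0

theorem supp_eq_of_card (hs : s ∈ T.faces) (hx : x ∈ T.carrier s) (hcard : (T.supp x).card = 3) :
    T.supp x = s :=
  Finset.eq_of_subset_of_card_le (T.supp_subset hs hx) (by rw [hcard]; exact T.card_le hs)

theorem finite_nodes (h : T.IsSites W) : {x | T.IsNode W x}.Finite := by
  have hfin : (T.faces ×ˢ {N : Set P | N ⊆ W}).Finite :=
    T.finite_faces.prod h.finite.finite_subsets
  refine Set.Finite.of_finite_image (f := fun x => (T.supp x, T.near W x))
    (hfin.subset ?_) ?_
  · rintro _ ⟨x, -, rfl⟩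
    exact ⟨T.supp_mem x, fun w hw => hw.1⟩
  · intro x hx y hy hxy
    obtain ⟨h1, h2⟩ := Prod.mk.inj hxy
    by_contra hne
    obtain ⟨w, hw, w', hw', hww⟩ := hx.1
    have hs := T.supp_mem x
    have hxs := T.mem_carrier_supp x
    have hys : y ∈ T.carrier (T.supp x) := by
      rw [h1]
      exact T.mem_carrier_supp y
    have hhalf : (0 : ℝ) < 1 / 2 := by norm_num
    obtain ⟨z, hz, hze⟩ := (T.convex_image_carrier hs hs subset_rfl) ⟨x, hxs, rfl⟩ ⟨y, hys, rfl⟩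
      hhalf.le hhalf.le (by norm_num)
    obtain ⟨-, h3, h4⟩ := h.near_eq_pair_of_between hs hxs hys hz hne hhalf hhalf (by norm_num)
      hze.symm hww hw (h2 ▸ hw) hw' (h2 ▸ hw')
    refine hx.2 ?_ w w' ?_
    · rw [supp_eq_of_card hs hz h4] at h4
      exact h4
    · rw [← h3, ← h2, Set.inter_self]

/-- No three nodes of a simplex have two common nearest sites: they would be collinear, and the one
in the middle would not be a node. -/
theorem eq_or_eq_of_nodes (h : T.IsSites W) (hs : s ∈ T.faces) (ha : a ∈ T.carrier s)
    (hb : b ∈ T.carrier s) (hx : x ∈ T.carrier s) (hna : T.IsNode W a) (hnb : T.IsNode W b)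
    (hnx : T.IsNode W x) (hab : a ≠ b) (hww : w ≠ w')
    (hw : w ∈ T.near W a ∧ w ∈ T.near W b ∧ w ∈ T.near W x)
    (hw' : w' ∈ T.near W a ∧ w' ∈ T.near W b ∧ w' ∈ T.near W x) : x = a ∨ x = b := by
  have key : ∀ p q r : P, p ∈ T.carrier s → q ∈ T.carrier s → r ∈ T.carrier s →
      p ≠ q → q ≠ r → p ≠ r → T.IsNode W q → w ∈ T.near W p → w ∈ T.near W r →
      w' ∈ T.near W p → w' ∈ T.near W r → ¬ Wbtw ℝ (T.chart s p) (T.chart s q) (T.chart s r) := by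
    intro p q r hp hq hr hpq hqr hpr hnq h1 h2 h3 h4
    rintro ⟨c, ⟨hc0, hc1⟩, hc⟩
    rw [AffineMap.lineMap_apply_module] at hc
    have hc0' : c ≠ 0 := by
      rintro rfl
      simp only [sub_zero, one_smul, zero_smul, add_zero] at hc
      exact hpq (T.chart_injOn s hs hp hq hc)
    have hc1' : c ≠ 1 := by
      rintro rfl
      simp only [sub_self, one_smul, zero_smul, zero_add] at hc
      exact hqr (T.chart_injOn s hs hr hq hc).symm
    obtain ⟨e1, -, e2⟩ := h.near_eq_pair_of_between hs hp hr hq hpr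
      (sub_pos.2 (hc1.lt_of_ne hc1')) (hc0.lt_of_ne' hc0') (by ring) hc hww h1 h2 h3 h4
    exact hnq.2 e2 w w' e1
  have hinj : T.chart s w ≠ T.chart s w' := fun h0 => hww (T.chart_injOn s hs
    (h.mem_carrier_of_near hs ha hw.1) (h.mem_carrier_of_near hs ha hw'.1) h0)
  have hcol : Collinear ℝ {T.chart s a, T.chart s b, T.chart s x} := by
    refine collinear_of_dist_eq hinj ?_
    rintro _ (rfl | rfl | rfl)
    · exact h.dist_eq_of_near hs ha hw.1 hw'.1
    · exact h.dist_eq_of_near hs hb hw.2.1 hw'.2.1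
    · exact h.dist_eq_of_near hs hx hw.2.2 hw'.2.2
  by_contra! hne
  rcases hcol.wbtw_or_wbtw_or_wbtw with h0 | h0 | h0
  · exact key a b x ha hb hx hab hne.2.symm hne.1.symm hnb hw.1 hw.2.2 hw'.1 hw'.2.2 h0
  · exact key b x a hb hx ha hne.2.symm hne.1 hab.symm hnx hw.2.1 hw.1 hw'.2.1 hw'.1 h0
  · exact key x a b hx ha hb hne.1 hab hne.2 hna hw.2.2 hw.2.1 hw'.2.2 hw'.2.1 h0

end IsSites

/-! ### Points on Voronoi edges -/

namespace IsBisector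

variable {T : EuclideanTriangulation 2 P} {W : Set P} {s s' : Finset P}
  {a b m a' b' m' x y z w w' : P}

theorem symm (e : T.IsBisector W s a b m) : T.IsBisector W s b a m where
  face := e.face
  left_mem := e.right_mem
  right_mem := e.left_mem
  mem := e.mem
  left_node := e.right_node
  right_node := e.left_node
  ne := e.ne.symm
  common := by
    rw [Set.inter_comm]
    exact e.common
  eq := by rw [← e.eq, add_comm, add_comm (T.radius W b)]

theorem left_pos (e : T.IsBisector W s a b m) (h : T.IsSites W) :
    0 < T.radius W b / (T.radius W a + T.radius W b) := by
  have h1 := h.radius_pos e.left_node.1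
  have h2 := h.radius_pos e.right_node.1
  positivity

theorem right_pos (e : T.IsBisector W s a b m) (h : T.IsSites W) :
    0 < T.radius W a / (T.radius W a + T.radius W b) := by
  have h1 := h.radius_pos e.left_node.1
  have h2 := h.radius_pos e.right_node.1
  positivity

theorem sum_eq (e : T.IsBisector W s a b m) (h : T.IsSites W) :
    T.radius W b / (T.radius W a + T.radius W b) + T.radius W a / (T.radius W a + T.radius W b)
      = 1 := by
  have h1 := h.radius_pos e.left_node.1
  have h2 := h.radius_pos e.right_node.1
  field_simp
  ring

/-- The points strictly between the ends of an edge have the same two nearest sites. -/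
theorem near_of_between (e : T.IsBisector W s a b m) (h : T.IsSites W) (hx : x ∈ T.carrier s)
    {α β : ℝ} (hα : 0 < α) (hβ : 0 < β) (hab : α + β = 1)
    (hc : α • T.chart s a + β • T.chart s b = T.chart s x) :
    T.near W x = T.near W a ∩ T.near W b ∧ T.supp x = s ∧ ¬ T.IsNode W x := by
  obtain ⟨w, hw, w', hw', hne⟩ := e.common
  obtain ⟨h1, h2, h3⟩ := h.near_eq_pair_of_between e.face e.left_mem e.right_mem hx e.ne hα hβ hab
    hc hne hw.1 hw.2 hw'.1 hw'.2
  exact ⟨h1.trans h2.symm, IsSites.supp_eq_of_card e.face hx h3, fun hn => hn.2 h3 w w' h1⟩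

theorem near_eq (e : T.IsBisector W s a b m) (h : T.IsSites W) :
    T.near W m = T.near W a ∩ T.near W b :=
  (e.near_of_between h e.mem (e.left_pos h) (e.right_pos h) (e.sum_eq h) e.eq).1

theorem supp_eq (e : T.IsBisector W s a b m) (h : T.IsSites W) : T.supp m = s :=
  (e.near_of_between h e.mem (e.left_pos h) (e.right_pos h) (e.sum_eq h) e.eq).2.1

theorem not_isNode (e : T.IsBisector W s a b m) (h : T.IsSites W) : ¬ T.IsNode W m :=
  (e.near_of_between h e.mem (e.left_pos h) (e.right_pos h) (e.sum_eq h) e.eq).2.2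

theorem nontrivial (e : T.IsBisector W s a b m) (h : T.IsSites W) : (T.near W m).Nontrivial := by
  rw [e.near_eq h]
  exact e.common

/-- An edge is determined by any of its interior points. -/
theorem unique (e : T.IsBisector W s a b m) (e' : T.IsBisector W s' a' b' m') (h : T.IsSites W)
    (hn : T.near W a ∩ T.near W b = T.near W a' ∩ T.near W b') (hs : s = s') :
    (a' = a ∧ b' = b ∨ a' = b ∧ b' = a) ∧ m' = m := by
  subst hs
  obtain ⟨w, hw, w', hw', hne⟩ := e.common
  have hv := hn ▸ hw
  have hv' := hn ▸ hw'
  have h1 := h.eq_or_eq_of_nodes e.face e.left_mem e.right_mem e'.left_mem e.left_node e.right_node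
    e'.left_node e.ne hne ⟨hw.1, hw.2, hv.1⟩ ⟨hw'.1, hw'.2, hv'.1⟩
  have h2 := h.eq_or_eq_of_nodes e.face e.left_mem e.right_mem e'.right_mem e.left_node e.right_node
    e'.right_node e.ne hne ⟨hw.1, hw.2, hv.2⟩ ⟨hw'.1, hw'.2, hv'.2⟩
  have h3 : a' = a ∧ b' = b ∨ a' = b ∧ b' = a := by
    rcases h1 with rfl | rfl <;> rcases h2 with rfl | rfl
    · exact absurd rfl e'.ne
    · exact Or.inl ⟨rfl, rfl⟩
    · exact Or.inr ⟨rfl, rfl⟩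
    · exact absurd rfl e'.ne
  refine ⟨h3, T.chart_injOn s e.face e'.mem e.mem ?_⟩
  rcases h3 with ⟨rfl, rfl⟩ | ⟨rfl, rfl⟩
  · rw [← e.eq, ← e'.eq]
  · rw [← e.symm.eq, ← e'.eq]

theorem unique_of_eq (e : T.IsBisector W s a b m) (e' : T.IsBisector W s' a' b' m)
    (h : T.IsSites W) : s = s' ∧ (a' = a ∧ b' = b ∨ a' = b ∧ b' = a) := by
  have hs : s = s' := (e.supp_eq h).symm.trans (e'.supp_eq h)
  exact ⟨hs, (e.unique e' h ((e.near_eq h).symm.trans (e'.near_eq h)) hs).1⟩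

theorem exists_of_nodes {T : EuclideanTriangulation 2 P} (h : T.IsSites W) (hs : s ∈ T.faces)
    (ha : a ∈ T.carrier s) (hb : b ∈ T.carrier s) (hna : T.IsNode W a) (hnb : T.IsNode W b)
    (hab : a ≠ b) (hc : (T.near W a ∩ T.near W b).Nontrivial) : ∃ m, T.IsBisector W s a b m := by
  have h1 := h.radius_pos hna.1
  have h2 := h.radius_pos hnb.1
  obtain ⟨m, hm, hme⟩ := (T.convex_image_carrier hs hs subset_rfl) ⟨a, ha, rfl⟩ ⟨b, hb, rfl⟩
    (a := T.radius W b / (T.radius W a + T.radius W b))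
    (b := T.radius W a / (T.radius W a + T.radius W b)) (by positivity) (by positivity)
    (by field_simp; ring)
  exact ⟨m, hs, ha, hb, hm, hna, hnb, hab, hc, hme.symm⟩

theorem finite_bisectors {T : EuclideanTriangulation 2 P} (h : T.IsSites W) :
    {m | ∃ s a b, T.IsBisector W s a b m}.Finite := by
  have hfin := (T.finite_faces.prod (h.finite_nodes.prod h.finite_nodes))
  rcases isEmpty_or_nonempty P with hP | hP
  · exact Set.toFinite _
  choose! g hg using fun (k : Finset P × P × P) (hk : ∃ m, T.IsBisector W k.1 k.2.1 k.2.2 m) => hk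
  refine (hfin.image g).subset ?_
  rintro m ⟨s, a, b, e⟩
  refine ⟨(s, a, b), ⟨e.face, e.left_node, e.right_node⟩, ?_⟩
  have e' := hg (s, a, b) ⟨m, e⟩
  exact T.chart_injOn s e.face e'.mem e.mem (e'.eq.symm.trans e.eq)

end IsBisector

end EuclideanTriangulation

namespace EuclideanTriangulation

variable {P : Type*}

/-! ### The subdivision by cones over the cut locus -/

open Classical in
/-- The simplices into which the nodes and the bisecting points divide the set of points with more
than one nearest site. -/
inductive CutFace (T : EuclideanTriangulation 2 P) (W : Set P) : Finset P → Prop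
  | node {a : P} : T.IsNode W a → CutFace T W {a}
  | bisector {s : Finset P} {a b m : P} : T.IsBisector W s a b m → CutFace T W {m}
  | half {s : Finset P} {a b m : P} : T.IsBisector W s a b m → CutFace T W {a, m}

open Classical in
/-- The simplices of the subdivision of `P`: the sites, the simplices of the cut locus, and the cones
over the latter from their nearest sites. -/
def voronoiFaces (T : EuclideanTriangulation 2 P) (W : Set P) : Set (Finset P) :=
  {u | (∃ w ∈ W, u = {w}) ∨ T.CutFace W u ∨
    ∃ w v, T.CutFace W v ∧ (∀ p ∈ v, w ∈ T.near W p) ∧ u = insert w v}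

namespace CutFace

variable {T : EuclideanTriangulation 2 P} {W : Set P} {s s' u v v' : Finset P}
  {a b m x y z w w' : P} {l l' : P → ℝ}

theorem nonempty (hv : T.CutFace W v) : v.Nonempty := by
  classical
  cases hv <;> simp

theorem near_nontrivial (hv : T.CutFace W v) (h : T.IsSites W) (hx : x ∈ v) :
    (T.near W x).Nontrivial := by
  classical
  cases hv with
  | node ha =>
    rw [Finset.mem_singleton.1 hx]
    exact ha.1
  | bisector e =>
    rw [Finset.mem_singleton.1 hx]
    exact e.nontrivial h
  | half e =>
    rcases Finset.mem_insert.1 hx with rfl | hx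
    · exact e.left_node.1
    · rw [Finset.mem_singleton.1 hx]
      exact e.nontrivial h

theorem exists_face (hv : T.CutFace W v) : ∃ s ∈ T.faces, (v : Set P) ⊆ T.carrier s := by
  classical
  cases hv with
  | @node a _ => exact ⟨_, T.supp_mem a, by simpa using T.mem_carrier_supp a⟩
  | bisector e => exact ⟨_, e.face, by simpa using e.mem⟩
  | half e => exact ⟨_, e.face, by simp [Set.insert_subset_iff, e.mem, e.left_mem]⟩

theorem subset (hv : T.CutFace W v) (hu : u ⊆ v) (hne : u.Nonempty) : T.CutFace W u := by
  classical
  cases hv with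
  | node ha =>
    rw [(Finset.Nonempty.subset_singleton_iff hne).1 hu]
    exact .node ha
  | bisector e =>
    rw [(Finset.Nonempty.subset_singleton_iff hne).1 hu]
    exact .bisector e
  | @half s a b m e =>
    by_cases ha : a ∈ u <;> by_cases hm : m ∈ u
    · have : u = {a, m} := Finset.Subset.antisymm (by convert hu)
        (Finset.insert_subset ha (Finset.singleton_subset_iff.2 hm))
      rw [this]
      convert CutFace.half e
    · have : u ⊆ {a} := fun p hp => by
        rcases Finset.mem_insert.1 (hu hp) with rfl | hp'
        · simp
        · rw [Finset.mem_singleton] at hp'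
          exact absurd (hp' ▸ hp) hm
      rw [(Finset.Nonempty.subset_singleton_iff hne).1 this]
      exact .node e.left_node
    · have : u ⊆ {m} := fun p hp => by
        rcases Finset.mem_insert.1 (hu hp) with rfl | hp'
        · exact absurd hp ha
        · exact hp'
      rw [(Finset.Nonempty.subset_singleton_iff hne).1 this]
      exact .bisector e
    · obtain ⟨p, hp⟩ := hne
      rcases Finset.mem_insert.1 (hu hp) with rfl | hp'
      · exact absurd hp ha
      · rw [Finset.mem_singleton] at hp'
        exact absurd (hp' ▸ hp) hm

end CutFace

namespace IsComb

variable {T : EuclideanTriangulation 2 P} {W : Set P} {s s' u v v' : Finset P}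
  {a b m x y z w w' : P} {l l' : P → ℝ}

theorem eq_of_singleton (hc : T.IsComb s {a} l x) : x = a := by
  have h1 := hc.sum_eq
  have h2 := hc.sum_smul
  rw [Finset.sum_singleton] at h1 h2
  rw [h1, one_smul] at h2
  exact (T.chart_injOn s hc.face (hc.subset (by simp)) hc.mem h2).symm

open Classical in
theorem half_eq (e : T.IsBisector W s a b m) (h : T.IsSites W) (hc : T.IsComb s' {a, m} l x) :
    x ∈ T.carrier s ∧ 0 < l a ∧ 0 < l m ∧ l a + l m = 1 ∧
      l a • T.chart s a + l m • T.chart s m = T.chart s x := by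
  have hc' := hc.of_subset e.face (by simp [Set.insert_subset_iff, e.mem, e.left_mem])
  have ham : a ≠ m := fun h0 => e.not_isNode h (h0 ▸ e.left_node)
  have h1 := hc'.sum_eq
  have h2 := hc'.sum_smul
  rw [Finset.sum_pair ham] at h1 h2
  exact ⟨hc'.mem, hc'.pos a (by simp), hc'.pos m (by simp), h1, h2⟩

open Classical in
/-- Interior points of a half edge are interior points of the edge. -/
theorem half_near (e : T.IsBisector W s a b m) (h : T.IsSites W) (hc : T.IsComb s' {a, m} l x) :
    T.near W x = T.near W a ∩ T.near W b ∧ T.supp x = s ∧ ¬ T.IsNode W x := by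
  obtain ⟨hx, ha, hm, hsum, heq⟩ := half_eq e h hc
  have h1 := e.left_pos h
  have h2 := e.right_pos h
  have h3 := e.sum_eq h
  have h4 := e.eq
  set α := T.radius W b / (T.radius W a + T.radius W b)
  set β := T.radius W a / (T.radius W a + T.radius W b)
  refine e.near_of_between h hx (α := l a + l m * α) (β := l m * β) (by positivity)
    (by positivity) ?_ ?_
  · rw [add_assoc, ← mul_add, h3, mul_one, hsum]
  · rw [← heq, ← h4]
    module

open Classical in
/-- A bisecting point is not an interior point of any half edge. -/
theorem ne_bisector (e : T.IsBisector W s a b m) (h : T.IsSites W)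
    (e' : T.IsBisector W s' a' b' m') (hc' : T.IsComb u {a', m'} l m) : False := by
  obtain ⟨h1, h2, -⟩ := half_near e' h hc'
  obtain ⟨hx, ha, hm, hsum, heq⟩ := half_eq e' h hc'
  have hs : s = s' := (e.supp_eq h).symm.trans h2
  obtain ⟨-, rfl⟩ := e.unique e' h ((e.near_eq h).symm.trans h1) hs
  have : l a' • (T.chart s' a' - T.chart s' m') = 0 := by
    have h0 : l m' = 1 - l a' := by linarith
    rw [h0] at heq
    rw [← sub_eq_zero] at heq
    rw [← heq]
    module
  rw [smul_eq_zero, sub_eq_zero] at this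
  rcases this with h0 | h0
  · exact ha.ne' h0
  · have := T.chart_injOn s' e'.face e'.left_mem e'.mem h0
    exact e'.not_isNode h (this ▸ e'.left_node)

open Classical in
/-- The two halves of an edge have no common interior point. -/
theorem half_disjoint (e : T.IsBisector W s a b m) (h : T.IsSites W)
    (hc : T.IsComb u {a, m} l x) (hc' : T.IsComb v {b, m} l' x) : False := by
  obtain ⟨-, p1, p2, p3, p4⟩ := half_eq e h hc
  obtain ⟨-, q1, q2, q3, q4⟩ := half_eq e.symm h hc'
  have r1 := e.left_pos h
  have r2 := e.right_pos h
  have r3 := e.sum_eq h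
  have r4 := e.eq
  generalize T.radius W b / (T.radius W a + T.radius W b) = α at *
  generalize T.radius W a / (T.radius W a + T.radius W b) = β at *
  have : (l a * β + l' b * α) • (T.chart s a - T.chart s b) = 0 := by
    have hm1 : l m = 1 - l a := by linarith
    have hm2 : l' m = 1 - l' b := by linarith
    have hβ : β = 1 - α := by linarith
    rw [hm1] at p4
    rw [hm2] at q4
    rw [hβ] at r4 ⊢
    have := p4.trans q4.symm
    rw [← r4, ← sub_eq_zero] at this
    rw [← this]
    module
  rw [smul_eq_zero, sub_eq_zero] at this
  rcases this with h0 | h0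
  · have : 0 < l a * β + l' b * α := by positivity
    exact this.ne' h0
  · exact e.ne (T.chart_injOn s e.face e.left_mem e.right_mem h0)

/-- A point with several nearest sites lies in the interior of only one simplex of the cut locus. -/
theorem cutFace_unique (h : T.IsSites W) (hv : T.CutFace W v) (hv' : T.CutFace W v')
    (hc : T.IsComb s v l x) (hc' : T.IsComb s' v' l' x) : v = v' := by
  classical
  cases hv with
  | node ha =>
    obtain rfl := hc.eq_of_singleton
    cases hv' with
    | node ha' => rw [hc'.eq_of_singleton]
    | bisector e => exact absurd (hc'.eq_of_singleton ▸ ha) (e.not_isNode h)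
    | half e => exact absurd ha (half_near e h hc').2.2
  | bisector e =>
    obtain rfl := hc.eq_of_singleton
    cases hv' with
    | node ha' => exact absurd (hc'.eq_of_singleton ▸ ha') (e.not_isNode h)
    | bisector e' => rw [hc'.eq_of_singleton]
    | half e' => exact (ne_bisector e h e' hc').elim
  | @half s₀ a b m e =>
    obtain ⟨h1, h2, h3⟩ := half_near e h hc
    cases hv' with
    | node ha' => exact absurd (hc'.eq_of_singleton ▸ ha') h3
    | bisector e' =>
      obtain rfl := hc'.eq_of_singleton
      exact (ne_bisector e' h e hc).elim
    | half e' =>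
      obtain ⟨h1', h2', -⟩ := half_near e' h hc'
      obtain rfl : s₀ = _ := h2.symm.trans h2'
      obtain ⟨hends, rfl⟩ := e.unique e' h (h1.symm.trans h1') rfl
      rcases hends with ⟨rfl, rfl⟩ | ⟨rfl, rfl⟩
      · rfl
      · exact (half_disjoint e h hc hc').elim

/-- The sites nearest to an interior point of a simplex of the cut locus are those nearest to all of
its vertices. -/
theorem near_cutFace (h : T.IsSites W) (hv : T.CutFace W v) (hc : T.IsComb s v l x) :
    (T.near W x).Nontrivial ∧ ∀ w, w ∈ T.near W x ↔ ∀ p ∈ v, w ∈ T.near W p := by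
  classical
  cases hv with
  | node ha =>
    obtain rfl := hc.eq_of_singleton
    exact ⟨ha.1, by simp⟩
  | bisector e =>
    obtain rfl := hc.eq_of_singleton
    exact ⟨e.nontrivial h, by simp⟩
  | half e =>
    have h1 := (half_near e h hc).1
    refine ⟨h1 ▸ e.common, fun w => ?_⟩
    simp only [Finset.mem_insert, Finset.mem_singleton, forall_eq_or_imp, forall_eq]
    rw [h1, e.near_eq h]
    exact ⟨fun hw => ⟨hw.1, hw⟩, fun hw => hw.2⟩

/-- A point in the open cone over a simplex of the cut locus lies strictly between the site and a
point of that simplex. -/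
theorem cone_apex [DecidableEq P] (h : T.IsSites W) (hv : T.CutFace W v)
    (hw : ∀ p ∈ v, w ∈ T.near W p) (hc : T.IsComb s (insert w v) l x) :
    ∃ y ∈ T.carrier s, ∃ k, T.IsComb s v k y ∧ 0 < l w ∧ l w < 1 ∧
      l w • T.chart s w + (1 - l w) • T.chart s y = T.chart s x := by
  have hwv : w ∉ v := fun hmem => by
    refine h.not_mem_of_nontrivial (hv.near_nontrivial h hmem) (hw w hmem).1
  have h1 := hc.sum_eq
  have h2 := hc.sum_smul
  rw [Finset.sum_insert hwv] at h1 h2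
  have hpos : 0 < ∑ p ∈ v, l p :=
    Finset.sum_pos (fun p hp => hc.pos p (Finset.mem_insert_of_mem hp)) hv.nonempty
  have hne : 1 - l w ≠ 0 := by linarith
  have hvs : (v : Set P) ⊆ T.carrier s := fun p hp => hc.subset (by simp [Finset.mem_coe.1 hp])
  have hk0 : ∀ p ∈ v, 0 < l p / (1 - l w) := fun p hp =>
    div_pos (hc.pos p (Finset.mem_insert_of_mem hp)) (by linarith)
  obtain ⟨y, hy, hye, hyc⟩ := T.exists_isComb (l := fun p => l p / (1 - l w)) hc.face hvs
    (fun p hp => (hk0 p hp).le) (by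
      rw [← Finset.sum_div, show ∑ p ∈ v, l p = 1 - l w by linarith, div_self hne])
  rw [Finset.filter_true_of_mem hk0] at hyc
  refine ⟨y, hy, _, hyc, hc.pos w (Finset.mem_insert_self _ _), by linarith, ?_⟩
  rw [hye, Finset.smul_sum, ← h2]
  congr 1
  refine Finset.sum_congr rfl fun p _ => ?_
  rw [smul_smul, mul_div_cancel₀ _ hne]

/-- In the situation of `cone_apex` the site is the only nearest site, and it is not the point
itself. -/
theorem near_cone [DecidableEq P] (h : T.IsSites W) (hv : T.CutFace W v)
    (hw : ∀ p ∈ v, w ∈ T.near W p) (hc : T.IsComb s (insert w v) l x) :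
    T.near W x = {w} ∧ x ≠ w := by
  obtain ⟨y, hy, k, hyc, h0, h1, he⟩ := cone_apex h hv hw hc
  obtain ⟨hn, hiff⟩ := near_cutFace h hv hyc
  have hwy : w ∈ T.near W y := (hiff w).2 hw
  have hws : w ∈ T.carrier s := hc.subset (by simp)
  have hsite := h.near_site hwy.1
  refine ⟨?_, ?_⟩
  · rw [h.near_between hc.face hws hy hc.mem h0 (sub_pos.2 h1) (by ring) he
      (by rw [hsite]; rfl) hwy, hsite, Set.inter_eq_left]
    simpa using hwy
  · rintro rfl
    have : (1 - l x) • (T.chart s y - T.chart s x) = 0 := by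
      rw [← sub_eq_zero] at he
      rw [← he]
      module
    rcases smul_eq_zero.1 this with h2 | h2
    · linarith
    · have := T.chart_injOn s hc.face hy hws (sub_eq_zero.1 h2)
      subst this
      exact h.not_mem_of_nontrivial hn hwy.1

/-- Along a ray from a site there is only one point where further sites become nearest. -/
theorem ray_unique (h : T.IsSites W) (hs : s ∈ T.faces) (hw : w ∈ T.carrier s)
    (hy : y ∈ T.carrier s) (hz : z ∈ T.carrier s) (hwy : w ∈ T.near W y) (hwz : w ∈ T.near W z)
    (hny : (T.near W y).Nontrivial) (hnz : (T.near W z).Nontrivial) {α β : ℝ}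
    (hα : α < 1) (hβ : β < 1)
    (he : α • T.chart s w + (1 - α) • T.chart s y = β • T.chart s w + (1 - β) • T.chart s z) :
    y = z := by
  have key : ∀ {y z : P} {α β : ℝ}, y ∈ T.carrier s → z ∈ T.carrier s → w ∈ T.near W z →
      (T.near W y).Nontrivial → α < 1 → β < 1 → α < β →
      α • T.chart s w + (1 - α) • T.chart s y ≠ β • T.chart s w + (1 - β) • T.chart s z := by
    intro y z α β hy hz hwz hny hα hβ hαβ he
    have h1 : 0 < 1 - α := sub_pos.2 hα
    have hsite := h.near_site hwz.1
    have := h.near_between hs hw hz hy (a := (β - α) / (1 - α)) (b := (1 - β) / (1 - α))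
      (w := w) (div_pos (by linarith) h1) (div_pos (by linarith) h1) (by field_simp; ring) (by
        rw [← sub_eq_zero] at he
        have h2 : T.chart s y = (1 - α)⁻¹ • ((1 - α) • T.chart s y) := by
          rw [smul_smul, inv_mul_cancel₀ h1.ne', one_smul]
        rw [h2, show (1 - α) • T.chart s y = (β - α) • T.chart s w + (1 - β) • T.chart s z by
          rw [← sub_eq_zero, ← he]; module, smul_add, smul_smul, smul_smul, div_eq_inv_mul,
          div_eq_inv_mul]) (by rw [hsite]; rfl) hwz
    rw [this, hsite] at hny
    exact Set.not_nontrivial_singleton (hny.mono Set.inter_subset_left)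
  rcases lt_trichotomy α β with hlt | rfl | hlt
  · exact absurd he (key hy hz hwz hny hα hβ hlt)
  · have h1 : (1 - α) • (T.chart s y - T.chart s z) = 0 := by
      rw [smul_sub, sub_eq_zero]
      exact add_left_cancel he
    rcases smul_eq_zero.1 h1 with h2 | h2
    · linarith
    · exact T.chart_injOn s hs hy hz (sub_eq_zero.1 h2)
  · exact absurd he.symm (key hz hy hwy hnz hβ hα hlt)

theorem voronoiFaces_unique (h : T.IsSites W) (hu : u ∈ T.voronoiFaces W)
    (hv : v ∈ T.voronoiFaces W) (hc : T.IsComb s u l x) (hc' : T.IsComb s' v l' x) : u = v := by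
  classical
  -- the three kinds of simplices are told apart by the nearest sites of their interior points
  have kinds : ∀ {u s l}, u ∈ T.voronoiFaces W → T.IsComb s u l x →
      (u = {x} ∧ T.near W x = {x}) ∨ (T.CutFace W u ∧ (T.near W x).Nontrivial) ∨
      ∃ w v, T.CutFace W v ∧ (∀ p ∈ v, w ∈ T.near W p) ∧ u = insert w v ∧
        T.near W x = {w} ∧ x ≠ w := by
    rintro u s l (⟨w, hw, rfl⟩ | hu | ⟨w, v, hv, hwv, rfl⟩) hc
    · obtain rfl := hc.eq_of_singleton
      exact Or.inl ⟨rfl, h.near_site hw⟩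
    · exact Or.inr (Or.inl ⟨hu, (near_cutFace h hu hc).1⟩)
    · obtain ⟨h1, h2⟩ := near_cone h hv hwv (by convert hc)
      exact Or.inr (Or.inr ⟨w, v, hv, hwv, by congr!, h1, h2⟩)
  rcases kinds hu hc with ⟨h1, h2⟩ | ⟨h1, h2⟩ | ⟨w, u0, h1, h2, rfl, h4, h5⟩ <;>
    rcases kinds hv hc' with ⟨k1, k2⟩ | ⟨k1, k2⟩ | ⟨w', v0, k1, k2, rfl, k4, k5⟩
  · rw [h1, k1]
  · rw [h2] at k2
    exact absurd k2 Set.not_nontrivial_singleton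
  · exact absurd (Set.singleton_injective (h2.symm.trans k4)) k5
  · rw [k2] at h2
    exact absurd h2 Set.not_nontrivial_singleton
  · exact cutFace_unique h h1 k1 hc hc'
  · rw [k4] at h2
    exact absurd h2 Set.not_nontrivial_singleton
  · exact absurd (Set.singleton_injective (k2.symm.trans h4)) h5
  · rw [h4] at k2
    exact absurd k2 Set.not_nontrivial_singleton
  · obtain rfl := Set.singleton_injective (h4.symm.trans k4)
    replace hc' := hc'.of_mem hc.face hc.mem
    obtain ⟨y, hy, k, hyc, h00, h01, he⟩ := cone_apex h h1 h2 hc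
    obtain ⟨z, hz, k', hzc, k00, k01, he'⟩ := cone_apex h k1 k2 hc'
    obtain ⟨hn, hiff⟩ := near_cutFace h h1 hyc
    obtain ⟨hn', hiff'⟩ := near_cutFace h k1 hzc
    obtain rfl := ray_unique h hc.face (hc.subset (by simp)) hy hz ((hiff w).2 h2)
      ((hiff' w).2 k2) hn hn' h01 k01 (he.trans he'.symm)
    rw [cutFace_unique h h1 k1 hyc hzc]

end IsComb

end EuclideanTriangulation

namespace EuclideanTriangulation

variable {P : Type*}

namespace IsSites

variable {T : EuclideanTriangulation 2 P} {W : Set P} {s u : Finset P} {a b m x y w w' : P}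

theorem isComb_singleton (hs : s ∈ T.faces) (hx : x ∈ T.carrier s) : T.IsComb s {x} 1 x :=
  ⟨hs, by simpa using hx, hx, by simp, by simp, by simp⟩

/-- From an interior point of a Voronoi edge one reaches a node in both directions. -/
theorem exists_node (h : T.IsSites W) (hcard : (T.supp x).card = 3) (hww : w ≠ w')
    (hx : T.near W x = {w, w'}) {v : EuclideanSpace ℝ (Fin 2)} (hv : v ≠ 0)
    (horth : inner ℝ v (T.chart (T.supp x) w - T.chart (T.supp x) w') = 0) :
    ∃ t : ℝ, 0 < t ∧ ∃ y ∈ T.carrier (T.supp x),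
      T.chart (T.supp x) y = T.chart (T.supp x) x + t • v ∧ T.IsNode W y ∧
        w ∈ T.near W y ∧ w' ∈ T.near W y := by
  have hs := T.supp_mem x
  have hxs := T.mem_carrier_supp x
  obtain ⟨t, ht, y, hy, hye, hN, hexit⟩ := h.exists_exit hs hxs hv (N := {w, w'}) hx.ge
    ⟨w, by simp⟩ (by
      have horth' : inner ℝ v (T.chart (T.supp x) w' - T.chart (T.supp x) w) = 0 := by
        rw [← neg_sub, inner_neg_right, horth, neg_zero]
      rintro p (rfl | rfl) q (rfl | rfl) <;> simp [horth, horth'])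
  have hnode : T.IsNode W y := by
    refine ⟨⟨w, hN (by simp), w', hN (by simp), hww⟩, fun hc p q hpq => ?_⟩
    have hsy : T.supp y = T.supp x := supp_eq_of_card hs hy hc
    refine hexit ?_ ?_
    · obtain ⟨c, hc0, rfl⟩ := T.exists_tangent_weights hs hcard v
      have := T.eventually_mem_convexHull hs hy (c := c) (by rwa [hsy])
      rwa [hsy] at this
    · have hsub : ({w, w'} : Set P) ⊆ {p, q} := hpq ▸ hN
      have : ({w, w'} : Set P) = {p, q} := Set.eq_of_subset_of_ncard_le hsub (by
        rw [Set.ncard_pair hww]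
        exact Set.ncard_insert_le p {q} |>.trans (by simp))
      rw [hpq, this]
  refine ⟨t, ht.lt_of_ne ?_, y, hy, hye, hnode, hN (by simp), hN (by simp)⟩
  rintro rfl
  rw [zero_smul, add_zero] at hye
  obtain rfl := T.chart_injOn _ hs hy hxs hye
  exact hnode.2 hcard w w' hx

open Classical in
theorem isComb_half (e : T.IsBisector W s a b m) (h : T.IsSites W) (hx : x ∈ T.carrier s)
    {α : ℝ} (hα : T.radius W b / (T.radius W a + T.radius W b) < α) (hα1 : α < 1)
    (hxe : α • T.chart s a + (1 - α) • T.chart s b = T.chart s x) :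
    ∃ l, T.IsComb s {a, m} l x := by
  have h0 := e.left_pos h
  have h1 := e.sum_eq h
  have h2 := e.eq
  generalize T.radius W b / (T.radius W a + T.radius W b) = γ at *
  obtain h3 : T.radius W a / (T.radius W a + T.radius W b) = 1 - γ := by linarith
  rw [h3] at h2
  have hγ : 0 < 1 - γ := by linarith
  have ham : a ≠ m := fun h0 => e.not_isNode h (h0 ▸ e.left_node)
  refine ⟨_, isComb_pair e.face e.left_mem e.mem hx ham (α := (α - γ) / (1 - γ))
    (β := (1 - α) / (1 - γ)) (div_pos (by linarith) hγ) (div_pos (by linarith) hγ) ?_ ?_⟩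
  · field_simp
    ring
  · rw [← h2, ← hxe, smul_add, smul_smul, smul_smul, ← add_assoc, ← add_smul]
    congr 2
    · field_simp
      ring
    · field_simp

/-- The simplices of the cut locus cover the points with several nearest sites. -/
theorem exists_cutFace (h : T.IsSites W) (hx : (T.near W x).Nontrivial) :
    ∃ v, T.CutFace W v ∧ ∃ s l, T.IsComb s v l x := by
  classical
  have hs := T.supp_mem x
  have hxs := T.mem_carrier_supp x
  by_cases hnode : T.IsNode W x
  · exact ⟨{x}, .node hnode, _, _, isComb_singleton hs hxs⟩
  obtain ⟨hcard, w, w', hpair⟩ : (T.supp x).card = 3 ∧ ∃ w w', T.near W x = {w, w'} := by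
    by_contra! hcon
    exact hnode ⟨hx, hcon⟩
  have hww : w ≠ w' := by
    rintro rfl
    rw [hpair, Set.pair_eq_singleton] at hx
    exact Set.not_nontrivial_singleton hx
  have hw : w ∈ T.carrier (T.supp x) := h.mem_carrier_of_near hs hxs (by simp [hpair])
  have hw' : w' ∈ T.carrier (T.supp x) := h.mem_carrier_of_near hs hxs (by simp [hpair])
  have hd : T.chart (T.supp x) w - T.chart (T.supp x) w' ≠ 0 := fun h0 =>
    hww (T.chart_injOn _ hs hw hw' (sub_eq_zero.1 h0))
  obtain ⟨v, hv, horth⟩ : ∃ v : EuclideanSpace ℝ (Fin 2), v ≠ 0 ∧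
      inner ℝ v (T.chart (T.supp x) w - T.chart (T.supp x) w') = 0 := by
    have : Fact (Module.finrank ℝ (EuclideanSpace ℝ (Fin 2)) = 1 + 1) := ⟨by simp⟩
    obtain ⟨v, hv, -⟩ := finrank_eq_one_iff'.1
      (Submodule.finrank_orthogonal_span_singleton (𝕜 := ℝ) hd)
    exact ⟨v, fun h0 => hv (Subtype.ext h0),
      (Submodule.mem_orthogonal_singleton_iff_inner_left).1 v.2⟩
  obtain ⟨t, ht, a, ha, hae, hna, hwa, hwa'⟩ := h.exists_node hcard hww hpair hv horth
  obtain ⟨t', ht', b, hb, hbe, hnb, hwb, hwb'⟩ := h.exists_node hcard hww hpair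
    (neg_ne_zero.2 hv) (by rw [inner_neg_left, horth, neg_zero])
  have hpos : 0 < t + t' := by positivity
  have hxe : (t' / (t + t')) • T.chart (T.supp x) a + (1 - t' / (t + t')) • T.chart (T.supp x) b =
      T.chart (T.supp x) x := by
    rw [hae, hbe]
    match_scalars <;> field_simp <;> ring
  have hab : a ≠ b := by
    rintro rfl
    have : (t + t') • v = 0 := by
      rw [hae, ← sub_eq_zero] at hbe
      rw [← hbe]
      module
    exact (smul_ne_zero hpos.ne' hv) this
  obtain ⟨m, e⟩ := IsBisector.exists_of_nodes h hs ha hb hna hnb hab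
    ⟨w, ⟨hwa, hwb⟩, w', ⟨hwa', hwb'⟩, hww⟩
  have hlt1 : t' / (t + t') < 1 := (div_lt_one hpos).2 (by linarith)
  have hgt0 : 0 < t' / (t + t') := by positivity
  rcases lt_trichotomy (T.radius W b / (T.radius W a + T.radius W b)) (t' / (t + t')) with
    hlt | heq | hlt
  · obtain ⟨l, hl⟩ := isComb_half e h hxs hlt hlt1 hxe
    exact ⟨_, .half e, _, l, by convert hl⟩
  · have : x = m := by
      refine T.chart_injOn _ hs hxs e.mem ?_
      rw [← hxe, ← e.eq, ← heq, ← e.sum_eq h, add_sub_cancel_left]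
    subst this
    exact ⟨_, .bisector e, _, _, isComb_singleton hs hxs⟩
  · have hs1 := e.sum_eq h
    obtain ⟨l, hl⟩ := isComb_half e.symm h hxs (α := 1 - t' / (t + t'))
      (by rw [add_comm (T.radius W b)]; linarith) (by linarith) (by rw [← hxe]; module)
    exact ⟨_, .half e.symm, _, l, by convert hl⟩

/-- A point with a single nearest site is on a segment from this site to a point with several. -/
theorem exists_ray (h : T.IsSites W) (hx : T.near W x = {w}) (hne : x ≠ w) :
    ∃ y ∈ T.carrier (T.supp x), (T.near W y).Nontrivial ∧ w ∈ T.near W y ∧ ∃ α : ℝ, 0 < α ∧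
      α < 1 ∧ α • T.chart (T.supp x) w + (1 - α) • T.chart (T.supp x) y =
        T.chart (T.supp x) x := by
  have hs := T.supp_mem x
  have hxs := T.mem_carrier_supp x
  have hwx : w ∈ T.near W x := by simp [hx]
  have hw := h.mem_carrier_of_near hs hxs hwx
  have hv : T.chart (T.supp x) x - T.chart (T.supp x) w ≠ 0 := fun h0 =>
    hne (T.chart_injOn _ hs hxs hw (sub_eq_zero.1 h0))
  obtain ⟨t, ht, y, hy, hye, hN, hexit⟩ := h.exists_exit hs hxs hv (N := {w}) hx.ge
    ⟨w, rfl⟩ (by rintro p rfl q rfl; simp)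
  have hwy : w ∈ T.near W y := hN rfl
  have h1t : 0 < 1 + t := by positivity
  have hny : (T.near W y).Nontrivial := by
    by_contra hnt
    have hsub : T.near W y ⊆ {w} := by
      rw [Set.not_nontrivial_iff] at hnt
      exact fun p hp => hnt hp hwy
    -- `y` and `w` lie in the minimal simplex of `y`, so the direction is tangent to it
    refine hexit ?_ hsub
    have hss := T.supp_subset hs hy
    obtain ⟨ly, -, hly1, hlye⟩ := T.exists_weights_face hs (T.supp_mem y) hss
      (T.mem_carrier_supp y)
    obtain ⟨lw, -, hlw1, hlwe⟩ := T.exists_weights_face hs (T.supp_mem y) hss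
      (h.mem_carrier_of_near (T.supp_mem y) (T.mem_carrier_supp y) hwy)
    have := T.eventually_mem_convexHull hs hy (c := fun p => (1 + t)⁻¹ * (ly p - lw p)) (by
      rw [← Finset.mul_sum, Finset.sum_sub_distrib, hly1, hlw1, sub_self, mul_zero])
    have he : ∑ p ∈ T.supp y, ((1 + t)⁻¹ * (ly p - lw p)) • T.chart (T.supp x) p =
        T.chart (T.supp x) x - T.chart (T.supp x) w := by
      simp only [mul_smul, sub_smul]
      rw [← Finset.smul_sum, Finset.sum_sub_distrib, hlye, hlwe, inv_smul_eq_iff₀ h1t.ne', hye]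
      module
    rwa [he] at this
  have ht0 : t ≠ 0 := by
    rintro rfl
    rw [zero_smul, add_zero] at hye
    obtain rfl := T.chart_injOn _ hs hy hxs hye
    rw [hx] at hny
    exact Set.not_nontrivial_singleton hny
  have htp := ht.lt_of_ne' ht0
  refine ⟨y, hy, hny, hwy, t / (1 + t), by positivity, (div_lt_one h1t).2 (by linarith), ?_⟩
  rw [hye]
  match_scalars <;> field_simp <;> ring

theorem exists_voronoiFace (h : T.IsSites W) (x : P) :
    ∃ u ∈ T.voronoiFaces W, ∃ s l, T.IsComb s u l x := by
  classical
  have hs := T.supp_mem x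
  have hxs := T.mem_carrier_supp x
  by_cases hxW : x ∈ W
  · exact ⟨{x}, Or.inl ⟨x, hxW, rfl⟩, _, _, isComb_singleton hs hxs⟩
  by_cases hnt : (T.near W x).Nontrivial
  · obtain ⟨v, hv, hc⟩ := h.exists_cutFace hnt
    exact ⟨v, Or.inr (Or.inl hv), hc⟩
  obtain ⟨w, hw⟩ := h.near_nonempty x
  have hx : T.near W x = {w} := by
    rw [Set.not_nontrivial_iff] at hnt
    exact Set.eq_singleton_iff_unique_mem.2 ⟨hw, fun p hp => hnt hp hw⟩
  have hne : x ≠ w := fun h0 => hxW (h0 ▸ hw.1)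
  obtain ⟨y, hy, hny, hwy, α, hα0, hα1, he⟩ := h.exists_ray hx hne
  obtain ⟨v, hv, s', l, hc⟩ := h.exists_cutFace hny
  replace hc := hc.of_mem hs hy
  have hwp := ((hc.near_cutFace h hv).2 w).1 hwy
  have hwv : w ∉ v := fun hmem =>
    h.not_mem_of_nontrivial (hv.near_nontrivial h hmem) (hwp w hmem).1
  have hne' : ∀ p ∈ v, p ≠ w := fun p hp h0 => hwv (h0 ▸ hp)
  refine ⟨insert w v, Or.inr (Or.inr ⟨w, v, hv, hwp, by congr!⟩), T.supp x,
    fun p => if p = w then α else (1 - α) * l p, hs, ?_, hxs, ?_, ?_, ?_⟩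
  · rw [Finset.coe_insert]
    exact Set.insert_subset (h.mem_carrier_of_near hs hxs hw) hc.subset
  · intro p hp
    split_ifs with h0
    · exact hα0
    · exact mul_pos (sub_pos.2 hα1) (hc.pos p (Finset.mem_of_mem_insert_of_ne hp h0))
  · rw [Finset.sum_insert hwv, if_pos rfl, Finset.sum_congr rfl fun p hp => if_neg (hne' p hp),
      ← Finset.mul_sum, hc.sum_eq]
    ring
  · rw [Finset.sum_insert hwv, if_pos rfl, ← he, ← hc.sum_smul, Finset.smul_sum]
    congr 1
    refine Finset.sum_congr rfl fun p hp => ?_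
    rw [if_neg (hne' p hp), mul_smul]

end IsSites

/-! ### The folding map at the vertices -/

open Classical in
/-- The first coordinate of the image of a bisecting point on the edge with ends `a` and `b`. By the
law of cosines it is the length of the projection of the segment from a site of the edge to the
bisecting point onto the line from that site to `a`, and likewise for `b`. -/
noncomputable def bisectorAbscissa (T : EuclideanTriangulation 2 P) (W : Set P) (m : P) : ℝ :=
  if e : ∃ s a b, T.IsBisector W s a b m then
    ((T.radius W e.choose_spec.choose + T.radius W e.choose_spec.choose_spec.choose) ^ 2 -
      dist (T.chart e.choose e.choose_spec.choose)
        (T.chart e.choose e.choose_spec.choose_spec.choose) ^ 2) /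
    (2 * (T.radius W e.choose_spec.choose + T.radius W e.choose_spec.choose_spec.choose))
  else 0

open Classical in
/-- The values of the folding map at the vertices of the subdivision: sites go to the origin, nodes
to the positive first coordinate axis, and bisecting points above that axis, each at the
right distance from the origin. -/
noncomputable def foldVertex (T : EuclideanTriangulation 2 P) (W : Set P) (p : P) :
    EuclideanSpace ℝ (Fin 2) :=
  if p ∈ W then 0
  else if T.IsNode W p then !₂[T.radius W p, 0]
  else !₂[T.bisectorAbscissa W p, √(T.radius W p ^ 2 - T.bisectorAbscissa W p ^ 2)]

namespace IsBisector

variable {T : EuclideanTriangulation 2 P} {W : Set P} {s : Finset P} {a b m w : P}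

theorem abscissa_eq (e : T.IsBisector W s a b m) (h : T.IsSites W) :
    T.bisectorAbscissa W m = ((T.radius W a + T.radius W b) ^ 2 -
      dist (T.chart s a) (T.chart s b) ^ 2) / (2 * (T.radius W a + T.radius W b)) := by
  have he : ∃ s a b, T.IsBisector W s a b m := ⟨s, a, b, e⟩
  rw [bisectorAbscissa, dif_pos he]
  have e' := he.choose_spec.choose_spec.choose_spec
  generalize he.choose_spec.choose_spec.choose = b' at *
  generalize he.choose_spec.choose = a' at *
  generalize he.choose = s' at *
  obtain ⟨rfl, ⟨rfl, rfl⟩ | ⟨rfl, rfl⟩⟩ := e.unique_of_eq e' h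
  · rfl
  · rw [add_comm (T.radius W a'), dist_comm]

theorem radius_sq (e : T.IsBisector W s a b m) (h : T.IsSites W) :
    T.radius W m ^ 2 = T.radius W a * T.radius W b *
      (1 - dist (T.chart s a) (T.chart s b) ^ 2 / (T.radius W a + T.radius W b) ^ 2) := by
  obtain ⟨w, hw⟩ := h.near_nonempty m
  have hw' := hw
  rw [e.near_eq h] at hw'
  have h1 := h.radius_pos e.left_node.1
  have h2 := h.radius_pos e.right_node.1
  rw [← h.radius_eq e.face e.mem hw, ← e.eq, dist_sq_convex_comb _ _ _ (e.sum_eq h),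
    h.radius_eq e.face e.left_mem hw'.1, h.radius_eq e.face e.right_mem hw'.2]
  field_simp

theorem dist_left (e : T.IsBisector W s a b m) (h : T.IsSites W) :
    dist (T.chart s a) (T.chart s m) =
      T.radius W a / (T.radius W a + T.radius W b) * dist (T.chart s a) (T.chart s b) := by
  have h3 := e.sum_eq h
  rw [← e.eq, show T.radius W b / (T.radius W a + T.radius W b) =
    1 - T.radius W a / (T.radius W a + T.radius W b) by linarith, dist_eq_norm, dist_eq_norm,
    ← abs_of_pos (e.right_pos h), ← Real.norm_eq_abs, ← norm_smul, Real.norm_eq_abs,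
    abs_of_pos (e.right_pos h)]
  congr 1
  module

theorem abscissa_sq_le (e : T.IsBisector W s a b m) (h : T.IsSites W) :
    T.bisectorAbscissa W m ^ 2 ≤ T.radius W m ^ 2 := by
  obtain ⟨w, hw⟩ := h.near_nonempty m
  rw [e.near_eq h] at hw
  have h1 := h.radius_pos e.left_node.1
  have h2 := h.radius_pos e.right_node.1
  have ra := h.radius_eq e.face e.left_mem hw.1
  have rb := h.radius_eq e.face e.right_mem hw.2
  have t1 := dist_triangle_right (T.chart s a) (T.chart s b) (T.chart s w)
  have t2 := dist_triangle (T.chart s a) (T.chart s b) (T.chart s w)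
  have t3 := dist_triangle_left (T.chart s b) (T.chart s w) (T.chart s a)
  rw [ra, rb] at t1 t2 t3
  rw [e.abscissa_eq h, e.radius_sq h]
  set d := dist (T.chart s a) (T.chart s b)
  have hd : 0 ≤ d := dist_nonneg
  set p := T.radius W a
  set q := T.radius W b
  have hA : 0 ≤ (p + q) ^ 2 - d ^ 2 := by nlinarith
  have hB : (p + q) ^ 2 - d ^ 2 ≤ 4 * (p * q) := by nlinarith [abs_le_of_sq_le_sq' (a := p - q) (b := d)]
  have hpq : 0 < p + q := by positivity
  have e1 : (((p + q) ^ 2 - d ^ 2) / (2 * (p + q))) ^ 2 =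
      ((p + q) ^ 2 - d ^ 2) * ((p + q) ^ 2 - d ^ 2) / (4 * (p + q) ^ 2) := by
    rw [div_pow]; ring
  have e2 : p * q * (1 - d ^ 2 / (p + q) ^ 2) =
      (4 * (p * q)) * ((p + q) ^ 2 - d ^ 2) / (4 * (p + q) ^ 2) := by
    field_simp
  rw [e1, e2]
  gcongr

end IsBisector

namespace IsSites

variable {T : EuclideanTriangulation 2 P} {W : Set P} {s u v : Finset P} {a b m p q x y w w' : P}

theorem foldVertex_site (hw : w ∈ W) : T.foldVertex W w = 0 := if_pos hw

theorem foldVertex_node (h : T.IsSites W) (ha : T.IsNode W a) :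
    T.foldVertex W a = !₂[T.radius W a, 0] := by
  rw [foldVertex, if_neg (h.not_mem_of_nontrivial ha.1), if_pos ha]

theorem foldVertex_bisector (h : T.IsSites W) (e : T.IsBisector W s a b m) :
    T.foldVertex W m = !₂[T.bisectorAbscissa W m,
      √(T.radius W m ^ 2 - T.bisectorAbscissa W m ^ 2)] := by
  rw [foldVertex, if_neg (h.not_mem_of_nontrivial (e.nontrivial h)), if_neg (e.not_isNode h)]

theorem norm_foldVertex (h : T.IsSites W) (hv : T.CutFace W v) (hp : p ∈ v) :
    ‖T.foldVertex W p‖ = T.radius W p := by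
  classical
  have hr : 0 ≤ T.radius W p := (h.radius_pos (hv.near_nontrivial h hp)).le
  have hnode : ∀ {a}, T.IsNode W a → ‖T.foldVertex W a‖ = T.radius W a := fun ha => by
    have := h.radius_pos ha.1
    rw [h.foldVertex_node ha, EuclideanSpace.norm_eq]
    simp [Real.sqrt_sq_eq_abs, abs_of_pos this]
  have hbis : ∀ {s a b m}, T.IsBisector W s a b m → ‖T.foldVertex W m‖ = T.radius W m := fun e => by
    have := h.radius_pos (e.nontrivial h)
    have h2 := sub_nonneg.2 (e.abscissa_sq_le h)
    rw [h.foldVertex_bisector e, EuclideanSpace.norm_eq]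
    simp [Real.sq_sqrt h2, Real.sqrt_sq_eq_abs, abs_of_pos this]
  cases hv with
  | node ha =>
    rw [Finset.mem_singleton.1 hp]
    exact hnode ha
  | bisector e =>
    rw [Finset.mem_singleton.1 hp]
    exact hbis e
  | half e =>
    rcases Finset.mem_insert.1 hp with rfl | hp
    · exact hnode e.left_node
    · rw [Finset.mem_singleton.1 hp]
      exact hbis e

theorem dist_foldVertex_half (h : T.IsSites W) (e : T.IsBisector W s a b m) :
    dist (T.foldVertex W a) (T.foldVertex W m) = dist (T.chart s a) (T.chart s m) := by
  have h1 := h.radius_pos e.left_node.1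
  have h2 := h.radius_pos e.right_node.1
  have h3 := sub_nonneg.2 (e.abscissa_sq_le h)
  refine (pow_left_inj₀ dist_nonneg dist_nonneg two_ne_zero).1 ?_
  rw [h.foldVertex_node e.left_node, h.foldVertex_bisector e, EuclideanSpace.dist_eq,
    Real.sq_sqrt (by positivity)]
  simp only [Fin.sum_univ_two, Real.dist_eq, sq_abs, Matrix.cons_val_zero,
    Matrix.cons_val_one, zero_sub, neg_sq]
  rw [Real.sq_sqrt h3, e.radius_sq h, e.abscissa_eq h, e.dist_left h]
  field_simp
  ring

theorem dist_foldVertex_cutFace (h : T.IsSites W) (hv : T.CutFace W v) (hs : s ∈ T.faces)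
    (hvs : (v : Set P) ⊆ T.carrier s) (hp : p ∈ v) (hq : q ∈ v) :
    dist (T.foldVertex W p) (T.foldVertex W q) = dist (T.chart s p) (T.chart s q) := by
  classical
  cases hv with
  | node ha => rw [Finset.mem_singleton.1 hp, Finset.mem_singleton.1 hq]; simp
  | bisector e => rw [Finset.mem_singleton.1 hp, Finset.mem_singleton.1 hq]; simp
  | @half s' a b m e =>
    have key : dist (T.foldVertex W a) (T.foldVertex W m) = dist (T.chart s a) (T.chart s m) := by
      rw [h.dist_foldVertex_half e]
      exact T.dist_chart_eq e.face hs e.left_mem e.mem (hvs (by simp)) (hvs (by simp))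
    simp only [Finset.mem_insert, Finset.mem_singleton] at hp hq
    rcases hp with rfl | rfl <;> rcases hq with rfl | rfl
    · simp
    · exact key
    · rw [dist_comm, key, dist_comm]
    · simp

theorem finite_voronoiFaces (h : T.IsSites W) : (T.voronoiFaces W).Finite := by
  classical
  have hV := (h.finite.union h.finite_nodes).union (IsBisector.finite_bisectors h)
  refine (hV.toFinset.powerset.finite_toSet).subset fun u hu => ?_
  rw [Finset.mem_coe, Finset.mem_powerset]
  intro p hp
  rw [Set.Finite.mem_toFinset]
  have hcut : ∀ {v}, T.CutFace W v → p ∈ v →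
      p ∈ W ∪ {x | T.IsNode W x} ∪ {m | ∃ s a b, T.IsBisector W s a b m} := by
    intro v hv hp
    cases hv with
    | node ha => rw [Finset.mem_singleton.1 hp]; exact Or.inl (Or.inr ha)
    | bisector e => rw [Finset.mem_singleton.1 hp]; exact Or.inr ⟨_, _, _, e⟩
    | half e =>
      rcases Finset.mem_insert.1 hp with rfl | hp
      · exact Or.inl (Or.inr e.left_node)
      · rw [Finset.mem_singleton.1 hp]; exact Or.inr ⟨_, _, _, e⟩
  rcases hu with ⟨w, hw, rfl⟩ | hu | ⟨w, v, hv, hwv, rfl⟩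
  · rw [Finset.mem_singleton.1 hp]
    exact Or.inl (Or.inl hw)
  · exact hcut hu hp
  · rcases Finset.mem_insert.1 hp with rfl | hp
    · obtain ⟨q, hq⟩ := hv.nonempty
      exact Or.inl (Or.inl (hwv q hq).1)
    · exact hcut hv hp

theorem isSubdivision (h : T.IsSites W) :
    T.IsSubdivision (T.voronoiFaces W) (T.foldVertex W) where
  finite := h.finite_voronoiFaces
  nonempty u hu := by
    classical
    rcases hu with ⟨w, -, rfl⟩ | hu | ⟨w, v, -, -, rfl⟩
    · simp
    · exact hu.nonempty
    · simp
  down_closed u hu t htu ht := by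
    classical
    rcases hu with ⟨w, hw, rfl⟩ | hu | ⟨w, v, hv, hwv, rfl⟩
    · exact Or.inl ⟨w, hw, (Finset.Nonempty.subset_singleton_iff ht).1 htu⟩
    · exact Or.inr (Or.inl (hu.subset htu ht))
    · have hsub : t.erase w ⊆ v := by
        rw [← Finset.subset_insert_iff]
        convert htu
      rcases (t.erase w).eq_empty_or_nonempty with h0 | hne
      · obtain ⟨q, hq⟩ := hv.nonempty
        refine Or.inl ⟨w, (hwv q hq).1, ?_⟩
        refine (Finset.Nonempty.subset_singleton_iff ht).1 ?_
        rw [← insert_empty_eq, ← h0]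
        exact Finset.insert_erase_subset w t
      · have hcut := hv.subset hsub hne
        by_cases hwt : w ∈ t
        · refine Or.inr (Or.inr ⟨w, t.erase w, hcut, fun p hp => hwv p (hsub hp), ?_⟩)
          conv_lhs => rw [← Finset.insert_erase hwt]
        · rw [Finset.erase_eq_of_notMem hwt] at hcut
          exact Or.inr (Or.inl hcut)
  exists_face u hu := by
    classical
    rcases hu with ⟨w, -, rfl⟩ | hu | ⟨w, v, hv, hwv, rfl⟩
    · exact ⟨_, T.supp_mem w, by simpa using T.mem_carrier_supp w⟩
    · exact hu.exists_face
    · obtain ⟨s, hs, hvs⟩ := hv.exists_face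
      obtain ⟨q, hq⟩ := hv.nonempty
      refine ⟨s, hs, ?_⟩
      rw [Finset.coe_insert]
      exact Set.insert_subset (h.mem_carrier_of_near hs (hvs hq) (hwv q hq)) hvs
  exists_comb x := h.exists_voronoiFace x
  unique_comb hu hu' hc hc' := IsComb.voronoiFaces_unique h hu hu' hc hc'
  dist_eq u hu s hs hus p hp q hq := by
    classical
    rcases hu with ⟨w, -, rfl⟩ | hu | ⟨w, v, hv, hwv, rfl⟩
    · rw [Finset.mem_singleton.1 hp, Finset.mem_singleton.1 hq]
      simp
    · exact h.dist_foldVertex_cutFace hu hs hus hp hq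
    · rw [Finset.coe_insert, Set.insert_subset_iff] at hus
      have key : ∀ p ∈ v, dist (T.foldVertex W w) (T.foldVertex W p) =
          dist (T.chart s w) (T.chart s p) := fun p hp => by
        rw [foldVertex_site (hwv p hp).1, dist_zero_left, h.norm_foldVertex hv hp, dist_comm,
          h.radius_eq hs (hus.2 hp) (hwv p hp)]
      rcases Finset.mem_insert.1 hp with rfl | hp' <;>
        rcases Finset.mem_insert.1 hq with rfl | hq'
      · simp
      · exact key q hq'
      · rw [dist_comm, key p hp', dist_comm]
      · exact h.dist_foldVertex_cutFace hv hs hus.2 hp' hq'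

end IsSites

end EuclideanTriangulation

namespace EuclideanTriangulation

variable {P : Type*}

/-! ### Equally spaced sites on the edges -/

/-- The number of equal parts into which an edge of length `ℓ` is divided, so that the parts have
lengths close to `1 / N` if `N` is large. -/
noncomputable def parts (N : ℕ) (ℓ : ℝ) : ℕ := ⌈ℓ * N⌉₊ + 1

theorem parts_pos (N : ℕ) (ℓ : ℝ) : 0 < parts N ℓ := Nat.succ_pos _

/-- The points which divide the edges of `T` into equal parts of lengths about `1 / N`; the vertices
are among them. -/
def edgeSites (T : EuclideanTriangulation 2 P) (N : ℕ) : Set P :=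
  {x | ∃ s ∈ T.faces, x ∈ T.carrier s ∧ ∃ v ∈ s, ∃ v' ∈ s, ∃ k : ℕ,
    k ≤ parts N (dist (T.chart s v) (T.chart s v')) ∧
    T.chart s x = T.chart s v + ((k : ℝ) / parts N (dist (T.chart s v) (T.chart s v'))) •
      (T.chart s v' - T.chart s v)}

/-- Consider two edges which start at a common vertex in the directions of `A` and `B`, are
divided into `n` and `m` equal parts, and make an angle such that the parts of each edge are longer
than the projections onto it of the parts of the other. Then for the point `ξ • A` of the first edge
some division point of that edge is closer than the `k`-th division point of the second. It is one of
the ends or the `k`-th division point. -/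
theorem exists_closer {V : Type*} [NormedAddCommGroup V] [InnerProductSpace ℝ V] {A B : V}
    {n m k : ℕ} (hn : 0 < n) (hm : 0 < m) (hk : 0 < k)
    (h1 : inner ℝ A B * m < ‖B‖ ^ 2 * n) (h2 : inner ℝ A B * n < ‖A‖ ^ 2 * m)
    {ξ : ℝ} (hξ0 : 0 ≤ ξ) (hξ1 : ξ ≤ 1) :
    ∃ j : ℕ, j ≤ n ∧ ‖ξ • A - ((j : ℝ) / n) • A‖ < ‖ξ • A - ((k : ℝ) / m) • B‖ := by
  have hn' : (0 : ℝ) < n := Nat.cast_pos.2 hn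
  have hm' : (0 : ℝ) < m := Nat.cast_pos.2 hm
  have hk' : (0 : ℝ) < k := Nat.cast_pos.2 hk
  have hred : ∀ j : ℕ, -(2 * ξ * (j / n) * ‖A‖ ^ 2) + (j / n) ^ 2 * ‖A‖ ^ 2 <
      -(2 * ξ * (k / m) * inner ℝ A B) + (k / m) ^ 2 * ‖B‖ ^ 2 →
      ‖ξ • A - ((j : ℝ) / n) • A‖ < ‖ξ • A - ((k : ℝ) / m) • B‖ := by
    intro j hj
    refine (pow_lt_pow_iff_left₀ (norm_nonneg _) (norm_nonneg _) two_ne_zero).1 ?_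
    rw [norm_sub_sq_real, norm_sub_sq_real]
    simp only [norm_smul, inner_smul_left, inner_smul_right, mul_pow, Real.norm_eq_abs, sq_abs,
      conj_trivial, real_inner_self_eq_norm_sq]
    linarith
  have hb : 0 < ‖B‖ ^ 2 := by
    have : B ≠ 0 := by
      rintro rfl
      simp at h1
    positivity
  generalize inner ℝ A B = g at *
  generalize ‖A‖ ^ 2 = a at *
  generalize ‖B‖ ^ 2 = b at *
  have hy : (0 : ℝ) < k / m := by positivity
  by_cases h0 : 2 * ξ * g < k / m * b
  · refine ⟨0, Nat.zero_le n, hred 0 ?_⟩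
    simp only [Nat.cast_zero, zero_div]
    nlinarith
  rw [not_lt] at h0
  have hg : 0 < g := by
    have : 0 < 2 * ξ * g := lt_of_lt_of_le (by positivity) h0
    exact pos_of_mul_pos_right this (by positivity)
  have hgab : g ^ 2 < a * b := by
    have := mul_lt_mul'' h1 h2 (by positivity) (by positivity)
    have hnm : (0 : ℝ) < n * m := by positivity
    nlinarith
  rcases le_or_gt k n with hkn | hkn
  · refine ⟨k, hkn, hred k ?_⟩
    -- divide by `k` and use the bound from below for `ξ` that comes from the failure of `j = 0`
    have hgm : 0 < a / n - g / m := by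
      rw [sub_pos, div_lt_div_iff₀ hm' hn']
      exact h2
    have hξ : k / m * b / (2 * g) ≤ ξ := by
      rw [div_le_iff₀ (by positivity)]
      linarith
    have e1 : k * (a / n ^ 2 - b / m ^ 2) < 2 * (k / m * b / (2 * g)) * (a / n - g / m) := by
      have : 2 * (k / m * b / (2 * g)) * (a / n - g / m) - k * (a / n ^ 2 - b / m ^ 2) =
          k * a * (b * n - g * m) / (n ^ 2 * m * g) := by
        field_simp
        ring
      have ha : 0 < a := by nlinarith
      have h3 : 0 < k * a * (b * n - g * m) / (n ^ 2 * m * g) := by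
        have := sub_pos.2 h1
        positivity
      linarith
    have e2 : 2 * (k / m * b / (2 * g)) * (a / n - g / m) ≤ 2 * ξ * (a / n - g / m) := by
      gcongr
    have e3 := mul_lt_mul_of_pos_left (e1.trans_le e2) hk'
    have e4 : (k : ℝ) * (k * (a / n ^ 2 - b / m ^ 2)) =
        (k / n) ^ 2 * a - (k / m) ^ 2 * b := by
      field_simp
    have e5 : k * (2 * ξ * (a / n - g / m)) =
        2 * ξ * (k / n) * a - 2 * ξ * (k / m) * g := by
      field_simp
    linarith
  · refine ⟨n, le_rfl, hred n ?_⟩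
    rw [div_self hn'.ne']
    have hyb : g < k / m * b := by
      have hkn' : (n : ℝ) < k := Nat.cast_lt.2 hkn
      rw [div_mul_eq_mul_div, lt_div_iff₀ hm']
      nlinarith
    generalize (k : ℝ) / m = y at *
    -- the difference of the two sides is affine in `ξ`, and positive at `1 / 2` and at `1`
    have hhalf : 1 / 2 < ξ := by nlinarith
    have f1 : 0 < y * (y * b - g) := mul_pos hy (sub_pos.2 hyb)
    have f2 : 0 < y ^ 2 * b - 2 * y * g + a := by
      have : 0 < b * (y ^ 2 * b - 2 * y * g + a) := by nlinarith [sq_nonneg (y * b - g)]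
      exact pos_of_mul_pos_right this hb.le
    nlinarith [mul_nonneg (sub_nonneg.2 hξ1) f1.le, mul_pos (sub_pos.2 hhalf) f2]

/-- The two sides of an angle of a triangle do not have the same direction. -/
theorem inner_lt_of_ne {T : EuclideanTriangulation 2 P} {s : Finset P} (hs : s ∈ T.faces)
    {v p q : P} (hv : v ∈ s) (hp : p ∈ s) (hq : q ∈ s) (hvp : v ≠ p) (hvq : v ≠ q) (hpq : p ≠ q) :
    inner ℝ (T.chart s p - T.chart s v) (T.chart s q - T.chart s v) <
      ‖T.chart s p - T.chart s v‖ * ‖T.chart s q - T.chart s v‖ := by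
  classical
  rw [inner_lt_norm_mul_iff_real]
  intro he
  have hne : T.chart s q - T.chart s v ≠ 0 := fun h0 => hvq
    (T.chart_injOn s hs (T.vertices_subset s hs hv) (T.vertices_subset s hs hq)
      (sub_eq_zero.1 h0).symm)
  have hw : ∀ (c : ℝ) {r : P}, r ∈ s →
      ∑ i ∈ s, ((if i = r then c else 0) - if i = v then c else 0) = 0 ∧
      ∑ i ∈ s, ((if i = r then c else 0) - if i = v then c else 0) • T.chart s i =
        c • (T.chart s r - T.chart s v) := by
    intro c r hr
    simp only [sub_smul, ite_smul, zero_smul, Finset.sum_sub_distrib, Finset.sum_ite_eq', hr, hv,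
      if_true, sub_self, smul_sub, and_self]
  have := T.weights_eq hs (((hw _ hp).1).trans (hw _ hq).1.symm)
    ((hw _ hp).2.trans (he.trans (hw _ hq).2.symm)) p hp
  simp only [if_true, if_neg hvp.symm, if_neg hpq, sub_zero, norm_eq_zero] at this
  exact hne this

/-- If the number of parts is large, the parts of two edges have almost the same lengths. -/
theorem eventually_mul_parts_lt {g ℓ ℓ' : ℝ} (hℓ' : 0 < ℓ') (hg : g < ℓ * ℓ') :
    ∀ᶠ N : ℕ in Filter.atTop, g * parts N ℓ' < ℓ' ^ 2 * parts N ℓ := by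
  have hd : 0 < ℓ' * (ℓ * ℓ' - g) := mul_pos hℓ' (sub_pos.2 hg)
  obtain ⟨N₀, hN₀⟩ := exists_nat_gt (2 * g / (ℓ' * (ℓ * ℓ' - g)))
  filter_upwards [Filter.eventually_ge_atTop N₀] with N hN
  have hp : (0 : ℝ) < parts N ℓ := Nat.cast_pos.2 (parts_pos N ℓ)
  have hp' : (0 : ℝ) < parts N ℓ' := Nat.cast_pos.2 (parts_pos N ℓ')
  rcases le_or_gt g 0 with hg0 | hg0
  · have : g * parts N ℓ' ≤ 0 := mul_nonpos_of_nonpos_of_nonneg hg0 hp'.le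
    have : 0 < ℓ' ^ 2 * parts N ℓ := by positivity
    linarith
  have hN1 : 2 * g < N * (ℓ' * (ℓ * ℓ' - g)) := by
    rw [← div_lt_iff₀ hd]
    exact hN₀.trans_le (Nat.cast_le.2 hN)
  have h1 : (parts N ℓ' : ℝ) ≤ ℓ' * N + 2 := by
    have := (Nat.ceil_lt_add_one (show 0 ≤ ℓ' * N by positivity)).le
    rw [parts, Nat.cast_add, Nat.cast_one]
    linarith
  have h2 : ℓ * N ≤ parts N ℓ := by
    have := Nat.le_ceil (ℓ * N)
    rw [parts, Nat.cast_add, Nat.cast_one]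
    linarith
  calc g * parts N ℓ' ≤ g * (ℓ' * N + 2) := by gcongr
    _ < ℓ' ^ 2 * (ℓ * N) := by linarith
    _ ≤ ℓ' ^ 2 * parts N ℓ := by gcongr

section

variable {T : EuclideanTriangulation 2 P} {N : ℕ} {s t : Finset P} {v v' w x : P}

theorem mem_of_vertex_mem_carrier (hs : s ∈ T.faces) (ht : t ∈ T.faces) (hv : v ∈ s)
    (hvt : v ∈ T.carrier t) : v ∈ t := by
  have hvf : {v} ∈ T.faces := T.down_closed s hs _ (Finset.singleton_subset_iff.2 hv)
    (Finset.singleton_nonempty v)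
  obtain ⟨u, hu, huv, hut, -⟩ := T.inter _ hvf t ht v
    ⟨T.vertices_subset _ hvf (by simp), hvt⟩
  rw [(Finset.Nonempty.subset_singleton_iff (T.nonempty_of_mem u hu)).1 huv] at hut
  exact Finset.singleton_subset_iff.1 hut

theorem eq_of_mem_carrier_singleton (hv : {v} ∈ T.faces) (hx : x ∈ T.carrier {v}) : x = v := by
  obtain ⟨l, -, hl1, hlx⟩ := T.exists_weights hv hx
  rw [Finset.sum_singleton] at hl1 hlx
  rw [hl1, one_smul] at hlx
  exact (T.chart_injOn _ hv (T.vertices_subset _ hv (by simp)) hx hlx).symm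

theorem vertex_mem_edgeSites (hs : s ∈ T.faces) (hv : v ∈ s) : v ∈ T.edgeSites N :=
  ⟨s, hs, T.vertices_subset s hs hv, v, hv, v, hv, 0, Nat.zero_le _, by simp⟩

/-- The sites of a simplex can be described in its own chart. -/
theorem exists_of_mem_edgeSites (hs : s ∈ T.faces) (hw : w ∈ T.edgeSites N)
    (hws : w ∈ T.carrier s) : ∃ v ∈ s, ∃ v' ∈ s, ∃ k : ℕ,
      k ≤ parts N (dist (T.chart s v) (T.chart s v')) ∧
      T.chart s w = T.chart s v + ((k : ℝ) / parts N (dist (T.chart s v) (T.chart s v'))) •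
        (T.chart s v' - T.chart s v) := by
  classical
  obtain ⟨t, ht, hwt, v, hv, v', hv', k, hk, he⟩ := hw
  have hvt := T.vertices_subset t ht hv
  have hvt' := T.vertices_subset t ht hv'
  have hn := parts_pos N (dist (T.chart t v) (T.chart t v'))
  have hvertex : ∀ {p}, p ∈ t → w = p → ∃ v ∈ s, ∃ v' ∈ s, ∃ k : ℕ,
      k ≤ parts N (dist (T.chart s v) (T.chart s v')) ∧
      T.chart s w = T.chart s v + ((k : ℝ) / parts N (dist (T.chart s v) (T.chart s v'))) •
        (T.chart s v' - T.chart s v) := by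
    rintro p hp rfl
    have := mem_of_vertex_mem_carrier ht hs hp hws
    exact ⟨w, this, w, this, 0, Nat.zero_le _, by simp⟩
  by_cases hvv : v = v'
  · subst hvv
    refine hvertex hv (T.chart_injOn t ht hwt hvt ?_)
    rw [he, sub_self, smul_zero, add_zero]
  rcases Nat.eq_zero_or_pos k with rfl | hk0
  · refine hvertex hv (T.chart_injOn t ht hwt hvt ?_)
    rw [he, Nat.cast_zero, zero_div, zero_smul, add_zero]
  rcases hk.eq_or_lt with hkn | hkn
  · refine hvertex hv' (T.chart_injOn t ht hwt hvt' ?_)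
    rw [he, hkn, div_self (Nat.cast_pos.2 hn).ne', one_smul, add_sub_cancel]
  have hn' : (0 : ℝ) < parts N (dist (T.chart t v) (T.chart t v')) := Nat.cast_pos.2 hn
  have hα : 0 < (k : ℝ) / parts N (dist (T.chart t v) (T.chart t v')) := by positivity
  have hα1 : (k : ℝ) / parts N (dist (T.chart t v) (T.chart t v')) < 1 := by
    rw [div_lt_one hn']
    exact_mod_cast hkn
  have hc := (IsSites.isComb_pair ht hvt hvt' hwt hvv (sub_pos.2 hα1) hα (by ring)
    (by rw [he]; module)).of_mem hs hws
  have hvs := mem_of_vertex_mem_carrier ht hs hv (hc.subset (by simp))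
  have hvs' := mem_of_vertex_mem_carrier ht hs hv' (hc.subset (by simp))
  have hd := T.dist_chart_eq ht hs hvt hvt' (T.vertices_subset s hs hvs)
    (T.vertices_subset s hs hvs')
  refine ⟨v, hvs, v', hvs', k, hd ▸ hk, ?_⟩
  have := hc.sum_smul
  rw [Finset.sum_pair hvv, if_pos rfl, if_neg (Ne.symm hvv)] at this
  rw [← this, ← hd]
  module

theorem finite_edgeSites (T : EuclideanTriangulation 2 P) (N : ℕ) : (T.edgeSites N).Finite := by
  have : T.edgeSites N ⊆ ⋃ s ∈ T.faces, ⋃ v ∈ s, ⋃ v' ∈ s,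
      ⋃ k ∈ Finset.range (parts N (dist (T.chart s v) (T.chart s v')) + 1),
        {x | x ∈ T.carrier s ∧ T.chart s x = T.chart s v +
          ((k : ℝ) / parts N (dist (T.chart s v) (T.chart s v'))) •
            (T.chart s v' - T.chart s v)} := by
    rintro x ⟨s, hs, hx, v, hv, v', hv', k, hk, he⟩
    simp only [Set.mem_iUnion]
    exact ⟨s, hs, v, hv, v', hv', k, Finset.mem_range.2 (Nat.lt_succ_of_le hk), hx, he⟩
  refine Set.Finite.subset ?_ this
  refine T.finite_faces.biUnion fun s hs => s.finite_toSet.biUnion fun v _ =>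
    s.finite_toSet.biUnion fun v' _ => (Finset.finite_toSet _).biUnion fun k _ => ?_
  refine Set.Subsingleton.finite fun x hx y hy => ?_
  exact T.chart_injOn s hs hx.1 hy.1 (hx.2.trans hy.2.symm)

/-- A proper face of a simplex of dimension at most two is a vertex or a side, and in the latter case
the simplex has at most one further vertex. -/
theorem exists_vertices_of_ssubset (hs : s ∈ T.faces) (hts : t ⊆ s) (hne : t ≠ s) (ht : t.Nonempty) :
    (∃ p, t = {p}) ∨ ∃ p ∈ s, ∃ q ∈ s, p ≠ q ∧ (∀ r, r ∈ t ↔ r = p ∨ r = q) ∧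
      ∀ o ∈ s, ∀ o' ∈ s, o ∉ t → o' ∉ t → o = o' := by
  classical
  have hlt := Finset.card_lt_card (hts.ssubset_of_ne hne)
  have h3 := T.card_le hs
  have hpos := ht.card_pos
  obtain h1 | h2 : t.card = 1 ∨ t.card = 2 := by omega
  · exact Or.inl (Finset.card_eq_one.1 h1)
  · obtain ⟨p, q, hpq, rfl⟩ := Finset.card_eq_two.1 h2
    refine Or.inr ⟨p, hts (by simp), q, hts (by simp), hpq, by simp, fun o ho o' ho' hot hot' => ?_⟩
    have hc : (s \ {p, q}).card ≤ 1 := by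
      rw [Finset.card_sdiff_of_subset hts]
      omega
    exact Finset.card_le_one.1 hc o (Finset.mem_sdiff.2 ⟨ho, hot⟩) o' (Finset.mem_sdiff.2 ⟨ho', hot'⟩)

/-- On a line segment between two vertices lie the points `v + c • (v' - v)` with `0 ≤ c ≤ 1`. -/
theorem exists_mem_carrier_segment (hs : s ∈ T.faces) (ht : t ∈ T.faces) (hts : t ⊆ s) (hv : v ∈ t)
    (hv' : v' ∈ t) {c : ℝ} (hc0 : 0 ≤ c) (hc1 : c ≤ 1) :
    ∃ x ∈ T.carrier t, T.chart s x = T.chart s v + c • (T.chart s v' - T.chart s v) := by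
  obtain ⟨x, hx, hxe⟩ := T.convex_image_carrier hs ht hts
    ⟨v, T.vertices_subset t ht hv, rfl⟩ ⟨v', T.vertices_subset t ht hv', rfl⟩
    (sub_nonneg.2 hc1) hc0 (by ring)
  refine ⟨x, hx, hxe.trans ?_⟩
  module

end

theorem isSites_edgeSites (T : EuclideanTriangulation 2 P) {N : ℕ}
    (hN : ∀ s ∈ T.faces, ∀ v ∈ s, ∀ p ∈ s, ∀ q ∈ s, v ≠ p → v ≠ q → p ≠ q →
      inner ℝ (T.chart s p - T.chart s v) (T.chart s q - T.chart s v) *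
        parts N (dist (T.chart s v) (T.chart s q)) <
      ‖T.chart s q - T.chart s v‖ ^ 2 * parts N (dist (T.chart s v) (T.chart s p))) :
    T.IsSites (T.edgeSites N) where
  finite := T.finite_edgeSites N
  vertex_mem s hs v hv := vertex_mem_edgeSites hs hv
  nearest_mem s hs t ht hts x hx w hw hws hmin := by
    classical
    by_contra hwt
    have hne : t ≠ s := fun h0 => hwt (h0 ▸ hws)
    rcases exists_vertices_of_ssubset hs hts hne (T.nonempty_of_mem t ht) with
      ⟨p, rfl⟩ | ⟨p, hp, q, hq, hpq, hmem, huniq⟩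
    · -- the face is a vertex, which is a site
      obtain rfl := eq_of_mem_carrier_singleton ht hx
      have hxs := T.vertices_subset s hs (hts (Finset.mem_singleton_self x))
      have := hmin x (vertex_mem_edgeSites ht (by simp)) hxs
      rw [dist_self, dist_le_zero] at this
      exact hwt (T.chart_injOn s hs hxs hws this ▸ hx)
    -- the face is a side `p q` of a triangle, and the site is on another side
    obtain ⟨v, hv, v', hv', k, hk, he⟩ := exists_of_mem_edgeSites hs hw hws
    have hn := parts_pos N (dist (T.chart s v) (T.chart s v'))
    have hn' : (0 : ℝ) < parts N (dist (T.chart s v) (T.chart s v')) := Nat.cast_pos.2 hn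
    have key : ∀ p q o : P, p ∈ t → q ∈ t → (∀ r, r ∈ t ↔ r = p ∨ r = q) → p ≠ q → o ∈ s → o ∉ t →
        ∀ k : ℕ, 0 < k →
        T.chart s w ≠ T.chart s p + ((k : ℝ) / parts N (dist (T.chart s p) (T.chart s o))) •
          (T.chart s o - T.chart s p) := by
      intro p q o hp hq hmem hpq ho hot k hk he
      have hpo : p ≠ o := fun h0 => hot (h0 ▸ hp)
      have hqo : q ≠ o := fun h0 => hot (h0 ▸ hq)
      obtain ⟨ξ, hξ, hxe⟩ : ∃ ξ ∈ Set.Icc (0 : ℝ) 1,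
          T.chart s x = T.chart s p + ξ • (T.chart s q - T.chart s p) := by
        obtain ⟨l, hl, hl1, hlx⟩ := T.exists_weights_face hs ht hts hx
        have htpq : t = {p, q} := by
          ext r
          simp [hmem]
        rw [htpq, Finset.sum_pair hpq] at hl1 hlx
        have h1 := hl p hp
        have h2 := hl q hq
        refine ⟨l q, ⟨h2, by linarith⟩, ?_⟩
        rw [← hlx, show l p = 1 - l q by linarith]
        module
      have hc1 := hN s hs p (hts hp) q (hts hq) o ho hpq hpo hqo
      have hc2 := hN s hs p (hts hp) o ho q (hts hq) hpo hpq hqo.symm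
      rw [real_inner_comm] at hc2
      obtain ⟨j, hj, hlt⟩ := exists_closer (parts_pos _ _) (parts_pos _ _) hk hc1 hc2 hξ.1 hξ.2
      have hpos : (0 : ℝ) < parts N (dist (T.chart s p) (T.chart s q)) :=
        Nat.cast_pos.2 (parts_pos _ _)
      obtain ⟨w', hw', hwe'⟩ := exists_mem_carrier_segment hs hs subset_rfl (hts hp) (hts hq)
        (c := (j : ℝ) / parts N (dist (T.chart s p) (T.chart s q))) (by positivity)
        (by rw [div_le_one hpos]; exact_mod_cast hj)
      have hle := hmin w' ⟨s, hs, hw', p, hts hp, q, hts hq, j, hj, hwe'⟩ hw'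
      rw [dist_eq_norm, dist_eq_norm, hxe, he, hwe', add_sub_add_left_eq_sub,
        add_sub_add_left_eq_sub] at hle
      exact absurd hlt (not_lt.2 hle)
    have hside : ∀ v ∈ t, ∀ o ∈ s, o ∉ t → ∀ k : ℕ,
        T.chart s w ≠ T.chart s v + ((k : ℝ) / parts N (dist (T.chart s v) (T.chart s o))) •
          (T.chart s o - T.chart s v) := by
      intro v hv o ho hot k he
      rcases Nat.eq_zero_or_pos k with rfl | hk
      · rw [Nat.cast_zero, zero_div, zero_smul, add_zero] at he
        have := T.vertices_subset t ht hv
        exact hwt (T.chart_injOn s hs hws (T.carrier_mono s hs t ht hts this) he ▸ this)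
      · rcases (hmem v).1 hv with rfl | rfl
        · exact key v q o hv ((hmem q).2 (Or.inr rfl)) hmem hpq ho hot k hk he
        · exact key v p o hv ((hmem p).2 (Or.inl rfl)) (fun r => (hmem r).trans or_comm) hpq.symm
            ho hot k hk he
    by_cases hvt : v ∈ t <;> by_cases hvt' : v' ∈ t
    · obtain ⟨y, hy, hye⟩ := exists_mem_carrier_segment hs ht hts hvt hvt'
        (c := (k : ℝ) / parts N (dist (T.chart s v) (T.chart s v'))) (by positivity)
        (by rw [div_le_one hn']; exact_mod_cast hk)
      have := T.chart_injOn s hs hws (T.carrier_mono s hs t ht hts hy) (he.trans hye.symm)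
      exact hwt (this ▸ hy)
    · exact hside v hvt v' hv' hvt' k he
    · refine hside v' hvt' v hv hvt (parts N (dist (T.chart s v) (T.chart s v')) - k) ?_
      rw [he, dist_comm (T.chart s v'), Nat.cast_sub hk, sub_div, div_self hn'.ne']
      module
    · -- the site is the vertex opposite to the side
      obtain rfl := huniq v hv v' hv' hvt hvt'
      refine hside p ((hmem p).2 (Or.inl rfl)) v hv hvt
        (parts N (dist (T.chart s p) (T.chart s v))) ?_
      rw [he, sub_self, smul_zero, add_zero,
        div_self (Nat.cast_pos.2 (parts_pos N _)).ne', one_smul, add_sub_cancel]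

theorem exists_isSites (T : EuclideanTriangulation 2 P) : ∃ W, T.IsSites W := by
  have : ∀ᶠ N : ℕ in Filter.atTop, ∀ s ∈ T.faces, ∀ v ∈ s, ∀ p ∈ s, ∀ q ∈ s,
      v ≠ p → v ≠ q → p ≠ q →
      inner ℝ (T.chart s p - T.chart s v) (T.chart s q - T.chart s v) *
        parts N (dist (T.chart s v) (T.chart s q)) <
      ‖T.chart s q - T.chart s v‖ ^ 2 * parts N (dist (T.chart s v) (T.chart s p)) := by
    rw [Filter.eventually_all_finite T.finite_faces]
    intro s hs
    rw [Filter.eventually_all_finset]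
    intro v hv
    rw [Filter.eventually_all_finset]
    intro p hp
    rw [Filter.eventually_all_finset]
    intro q hq
    by_cases hvp : v = p
    · exact Filter.Eventually.of_forall fun _ h0 => absurd hvp h0
    by_cases hvq : v = q
    · exact Filter.Eventually.of_forall fun _ _ h0 => absurd hvq h0
    by_cases hpq : p = q
    · exact Filter.Eventually.of_forall fun _ _ _ h0 => absurd hpq h0
    have hpos : ∀ {r}, r ∈ s → v ≠ r → 0 < dist (T.chart s v) (T.chart s r) := fun hr hne =>
      dist_pos.2 fun h0 => hne
        (T.chart_injOn s hs (T.vertices_subset s hs hv) (T.vertices_subset s hs hr) h0)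
    have hlt := inner_lt_of_ne hs hv hp hq hvp hvq hpq
    rw [← dist_eq_norm, ← dist_eq_norm, dist_comm, dist_comm (T.chart s q)] at hlt
    refine (eventually_mul_parts_lt (hpos hq hvq) hlt).mono fun N hN _ _ _ => ?_
    rwa [← dist_eq_norm, dist_comm (T.chart s q)]
  obtain ⟨N, hN⟩ := this.exists
  exact ⟨_, T.isSites_edgeSites hN⟩

end EuclideanTriangulation

theorem mainTheorem4 (P : Type*) [MetricSpace P] (hP : IsPolyhedralSpace 2 P) :
    ∃ f : P → EuclideanSpace ℝ (Fin 2), IsPiecewiseDistancePreserving f := by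
  obtain ⟨T, hT, -⟩ := hP
  obtain ⟨W, hW⟩ := T.exists_isSites
  exact ⟨_, hW.isSubdivision.isPiecewiseDistancePreserving hT⟩
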